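/- Let $k$ be a field and let $X=X_0\sqcup X_1$ be a well-ordered set, where the letters of $X_i$ have parity $i\in\mathbb Z/2$; write $|a|$ for the parity of $a\in X$. A Leibniz superalgebra is an algebra $A=A_0\oplus A_1$ with $A_iA_j\subseteq A_{i+j}$ (indices mod 2) and $x(yz)=(xy)z-(-1)^{|y||z|}(xz)y$ for all homogeneous $x,y,z$. It is metabelian if it has a graded ideal $N$ with $N\cdot N=0$ such that $A/N$ has zero product. Let $\mathrm{Lbs}(X)$ be the free Leibniz superalgebra generated by $X$ over $k$, and $\mathrm{MLbs}(X)=\mathrm{Lbs}(X)/I$ the free metabelian Leibniz superalgebra, where $I$ is the ideal generated by all products $(ab)(cd)$ with $a,b,c,d\in\mathrm{Lbs}(X)$. Write $[a_1a_2\cdots a_n]=((\cdots((a_1a_2)a_3)\cdots)a_n)$ for the left-normed product; the elements $[a_1\cdots a_n]$ with $n\ge1$, $a_i\in X$, form a linear basis of $\mathrm{Lbs}(X)$. **Gröbner–Shirshov bases.** Order these basis elements (monomials) first by length, then lexicographically from the left. For $0\ne f\in \mathrm{Lbs}(X)$ let $\bar f$ be its largest monomial; $f$ is monic if $\bar f$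 has coefficient $1$, and homogeneous if $f\in\mathrm{Lbs}(X)_0\cup\mathrm{Lbs}(X)_1$. Let $S\subseteq\mathrm{Lbs}(X)$ be a (possibly empty) set of monic homogeneous elements. The normal polynomials of $s\in S$ are $[s\,a_1\cdots a_m]$ with $m\ge0$ and, if $\bar s$ has length $1$, also $[a_1\cdots a_t\,s\,a_{t+1}\cdots a_m]$ with $1\le t\le m$ (all $a_i\in X$); the normal $S$-polynomials are those of all $s\in S$. The set $S$ is a Gröbner–Shirshov basis in $\mathrm{Lbs}(X)$ if * for every $f\in S$ with $\bar f$ of length $>1$ and every monomial $u$ with $uf\neq0$, the element $uf$ is a linear combination of normal $S$-polynomials whose leading monomials have length at most $\ell(u)+\ell(\bar f)$; and * for all $f\ne g$ in $S$ and every normal polynomial $h$ of $g$ with $\bar h=\bar f$, the element $f-h$ is a linear combination of normal $S$-polynomials whose leading monomials are smaller than $\bar f$. Define $$S_1=\{[c_1\cdots c_p\,a_1a_2]-(-1)^{|a_1||a_2|}[c_1\cdots c_p\,a_2a_1] : p\ge2,\ c_1,\dots,c_p,a_1,a_2\in X,\ a_2<a_1\},$$ $$S_2=\{[c_1\cdots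 c_p\,aa] : p\ge2,\ c_1,\dots,c_p,a\in X,\ |a|=1\},\qquad S'=S_1\cup S_2 .$$ **Theorem.** 1. If $\operatorname{char}k=2$, then $S_1$ is a Gröbner–Shirshov basis in $\mathrm{Lbs}(X)$, the ideal it generates is $I$ (so $S_1$ is a Gröbner–Shirshov basis for $\mathrm{MLbs}(X)$), and the elements $[a_1a_2\cdots a_n]$ with $n\ge1$, $a_1,\dots,a_n\in X$ and $a_3\le a_4\le\cdots\le a_n$ (indexed by the words $a_1\cdots a_n$) form a linear basis of $\mathrm{MLbs}(X)$. 2. If $\operatorname{char}k\ne2$, then $S'$ is a Gröbner–Shirshov basis in $\mathrm{Lbs}(X)$, the ideal it generates is $I$ (so $S'$ is a Gröbner–Shirshov basis for $\mathrm{MLbs}(X)$), and the elements $[a_1a_2\cdots a_n]$ with $n\ge1$, $a_1,\dots,a_n\in X$, $a_3\le a_4\le\cdots\le a_n$, and $a_j\ne a_{j+1}$ whenever $3\le j<n$ and $|a_j|=1$ (indexed by the words $a_1\cdots a_n$), form a linear basis of $\mathrm{MLbs}(X)$. -/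

import Mathlib

noncomputable section

namespace LeibnizSuper

/-! ### Ideals and quotients of non-associative algebras -/

section Ideals

variable (k : Type*) [Field k] {A : Type*} [NonUnitalNonAssocRing A] [Module k A]

/-- A subspace `I` of `A` is an ideal: `x y` and `y x` lie in `I` for `x ∈ A`, `y ∈ I`. -/
def IsIdeal (I : Submodule k A) : Prop := ∀ x y : A, y ∈ I → x * y ∈ I ∧ y * x ∈ I

/-- The ideal `Id(S)` of `A` generated by `S`. -/
def idealSpan (S : Set A) : Submodule k A := sInf {I | IsIdeal k I ∧ S ⊆ I}

theorem isIdeal_idealSpan (S : Set A) : IsIdeal k (idealSpan k S) := by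
  intro x y hy
  simp only [idealSpan, Submodule.mem_sInf, Set.mem_ofPred_eq] at hy ⊢
  exact ⟨fun I hI => (hI.1 x y (hy I hI)).1, fun I hI => (hI.1 x y (hy I hI)).2⟩

theorem subset_idealSpan (S : Set A) : S ⊆ idealSpan k S := by
  intro s hs
  simp only [idealSpan, SetLike.mem_coe, Submodule.mem_sInf, Set.mem_ofPred_eq]
  exact fun I hI => hI.2 hs

theorem idealSpan_le {S : Set A} {I : Submodule k A} (hI : IsIdeal k I) (hS : S ⊆ I) :
    idealSpan k S ≤ I := sInf_le ⟨hI, hS⟩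

/-- The quotient algebra `A / Id(S)`. -/
def QuotientAlgebra (S : Set A) : Type _ := A ⧸ idealSpan k S

namespace QuotientAlgebra

variable (S : Set A)

instance : AddCommGroup (QuotientAlgebra k S) :=
  inferInstanceAs (AddCommGroup (A ⧸ idealSpan k S))

instance : Module k (QuotientAlgebra k S) :=
  inferInstanceAs (Module k (A ⧸ idealSpan k S))

/-- The canonical projection `A → A / Id(S)`. -/
def proj : A →ₗ[k] QuotientAlgebra k S := (idealSpan k S).mkQ

theorem proj_surjective : Function.Surjective (proj k S) := (idealSpan k S).mkQ_surjective

theorem proj_eq_zero {x : A} : proj k S x = 0 ↔ x ∈ idealSpan k S :=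
  Submodule.Quotient.mk_eq_zero _

/-- The product of classes is the class of the product. -/
instance : Mul (QuotientAlgebra k S) where
  mul := Quotient.map₂ (· * ·) (by
    intro a a' ha b b' hb
    have ha' : a - a' ∈ idealSpan k S := (Submodule.quotientRel_def _).1 ha
    have hb' : b - b' ∈ idealSpan k S := (Submodule.quotientRel_def _).1 hb
    refine (Submodule.quotientRel_def _).2 ?_
    have e : a * b - a' * b' = a * (b - b') + (a - a') * b' := by
      rw [mul_sub, sub_mul]; abel
    rw [e]
    exact add_mem (isIdeal_idealSpan k S a _ hb').1 (isIdeal_idealSpan k S b' _ ha').2)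

theorem proj_mul (x y : A) : proj k S (x * y) = proj k S x * proj k S y := rfl

instance : NonUnitalNonAssocRing (QuotientAlgebra k S) where
  left_distrib a b c := by
    obtain ⟨a, rfl⟩ := proj_surjective k S a
    obtain ⟨b, rfl⟩ := proj_surjective k S b
    obtain ⟨c, rfl⟩ := proj_surjective k S c
    rw [← map_add, ← proj_mul, ← proj_mul, ← proj_mul, ← map_add, mul_add]
  right_distrib a b c := by
    obtain ⟨a, rfl⟩ := proj_surjective k S a
    obtain ⟨b, rfl⟩ := proj_surjective k S b
    obtain ⟨c, rfl⟩ := proj_surjective k S c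
    rw [← map_add, ← proj_mul, ← proj_mul, ← proj_mul, ← map_add, add_mul]
  zero_mul a := by
    obtain ⟨a, rfl⟩ := proj_surjective k S a
    rw [← map_zero (proj k S), ← proj_mul, zero_mul]
  mul_zero a := by
    obtain ⟨a, rfl⟩ := proj_surjective k S a
    rw [← map_zero (proj k S), ← proj_mul, mul_zero]

instance [IsScalarTower k A A] : IsScalarTower k (QuotientAlgebra k S) (QuotientAlgebra k S) where
  smul_assoc t a b := by
    obtain ⟨a, rfl⟩ := proj_surjective k S a
    obtain ⟨b, rfl⟩ := proj_surjective k S b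
    simp only [smul_eq_mul]
    rw [← map_smul, ← proj_mul, ← proj_mul, ← map_smul, smul_mul_assoc]

instance [SMulCommClass k A A] : SMulCommClass k (QuotientAlgebra k S) (QuotientAlgebra k S) where
  smul_comm t a b := by
    obtain ⟨a, rfl⟩ := proj_surjective k S a
    obtain ⟨b, rfl⟩ := proj_surjective k S b
    simp only [smul_eq_mul]
    rw [← map_smul, ← proj_mul, ← proj_mul, ← map_smul, mul_smul_comm]

end QuotientAlgebra

end Ideals

/-! ### Leibniz superalgebras -/

section Superalgebras

variable (k : Type*) [Field k] {A : Type*} [NonUnitalNonAssocRing A] [Module k A]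

/-- The sign `(-1)^{ij}` of two parities. -/
def sgn (i j : ZMod 2) : k := (-1) ^ (i.val * j.val)

variable {k}

/-- `A = 𝒜 0 ⊕ 𝒜 1` is a superalgebra. -/
structure IsSuperalgebra (𝒜 : ZMod 2 → Submodule k A) : Prop where
  isCompl : IsCompl (𝒜 0) (𝒜 1)
  mul_mem : ∀ (i j : ZMod 2) (x y : A), x ∈ 𝒜 i → y ∈ 𝒜 j → x * y ∈ 𝒜 (i + j)

/-- `A = 𝒜 0 ⊕ 𝒜 1` is a Leibniz superalgebra:
`x(yz) = (xy)z - (-1)^{|z||y|} (xz)y` for homogeneous `x, y, z`. -/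
structure IsLeibnizSuperalgebra (𝒜 : ZMod 2 → Submodule k A) : Prop
    extends IsSuperalgebra 𝒜 where
  leibniz : ∀ (h i j : ZMod 2) (x y z : A), x ∈ 𝒜 h → y ∈ 𝒜 i → z ∈ 𝒜 j →
    x * (y * z) = (x * y) * z - sgn k j i • ((x * z) * y)

/-- A subspace that contains the homogeneous components of its elements. -/
def IsGraded (𝒜 : ZMod 2 → Submodule k A) (I : Submodule k A) : Prop :=
  I ≤ (I ⊓ 𝒜 0) ⊔ (I ⊓ 𝒜 1)

/-- `A` is metabelian: an extension of an abelian superalgebra `A / N` by an abelian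
superalgebra `N`, with `N` a graded ideal. -/
def IsMetabelian (𝒜 : ZMod 2 → Submodule k A) : Prop :=
  ∃ N : Submodule k A, IsIdeal k N ∧ IsGraded 𝒜 N ∧
    (∀ x ∈ N, ∀ y ∈ N, x * y = 0) ∧ (∀ x y : A, x * y ∈ N)

end Superalgebras

/-! ### Free (metabelian) Leibniz superalgebras -/

section Free

variable (k : Type*) [Field k] {X : Type*} (p : X → ZMod 2)

/-- The parity of a non-associative word; `p` is the parity of the letters, so that
`X₀ = {x | p x = 0}` and `X₁ = {x | p x = 1}`. -/
def parity : FreeMagma X → ZMod 2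
  | .of x => p x
  | .mul u v => parity u + parity v

variable (X) in
/-- A non-associative word as an element of the free non-associative algebra. -/
def term (u : FreeMagma X) : FreeNonUnitalNonAssocAlgebra k X := MonoidAlgebra.ofMagma k _ u

/-- The elements `u(vw) - (uv)w + (-1)^{|v||w|} (uw)v`, for non-associative words `u, v, w`. -/
def leibnizRelators : Set (FreeNonUnitalNonAssocAlgebra k X) :=
  {f | ∃ u v w : FreeMagma X, f = term k X (u * (v * w)) - term k X ((u * v) * w)
    + sgn k (parity p v) (parity p w) • term k X ((u * w) * v)}

/-- The free Leibniz superalgebra `Lbs(X)` over `k`. -/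
abbrev FreeLeibniz : Type _ := QuotientAlgebra k (leibnizRelators k p)

namespace FreeLeibniz

/-- The generators of `Lbs(X)`. -/
def gen (x : X) : FreeLeibniz k p :=
  QuotientAlgebra.proj k _ (FreeNonUnitalNonAssocAlgebra.of k x)

/-- The grading of `Lbs(X)`: the component of parity `i` is spanned by the classes of the
non-associative words of parity `i`. -/
def grading (i : ZMod 2) : Submodule k (FreeLeibniz k p) :=
  (Submodule.span k (term k X '' {u | parity p u = i})).map (QuotientAlgebra.proj k _)

end FreeLeibniz

/-- The products `(ab)(cd)` in `Lbs(X)`. -/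
def metabelianRelators : Set (FreeLeibniz k p) :=
  {f | ∃ a b c d : FreeLeibniz k p, f = (a * b) * (c * d)}

/-- The free metabelian Leibniz superalgebra `MLbs(X)` over `k`; that it is metabelian and has
the universal property is proved below. -/
abbrev FreeMetabelian : Type _ := QuotientAlgebra k (metabelianRelators k p)

namespace FreeMetabelian

/-- The generators of `MLbs(X)`. -/
def gen (x : X) : FreeMetabelian k p := QuotientAlgebra.proj k _ (FreeLeibniz.gen k p x)

/-- The grading of `MLbs(X)`, induced by that of `Lbs(X)`. -/
def grading (i : ZMod 2) : Submodule k (FreeMetabelian k p) :=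
  (FreeLeibniz.grading k p i).map (QuotientAlgebra.proj k _)

end FreeMetabelian

end Free

/-! ### `Lbs(X)` and `MLbs(X)` are the free objects -/

section Superalgebras

variable {k : Type*} [Field k] {A : Type*} [NonUnitalNonAssocRing A] [Module k A]

theorem parity_cases (i : ZMod 2) : i = 0 ∨ i = 1 := by
  revert i; decide

theorem IsSuperalgebra.le_sup {𝒜 : ZMod 2 → Submodule k A} (I : Submodule k A) (i : ZMod 2)
    {x : A} (hx : x ∈ I) (hi : x ∈ 𝒜 i) : x ∈ (I ⊓ 𝒜 0) ⊔ (I ⊓ 𝒜 1) := by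
  rcases parity_cases i with rfl | rfl
  · exact Submodule.mem_sup_left ⟨hx, hi⟩
  · exact Submodule.mem_sup_right ⟨hx, hi⟩

theorem IsSuperalgebra.exists_add {𝒜 : ZMod 2 → Submodule k A} (h : IsSuperalgebra 𝒜) (x : A) :
    ∃ y ∈ 𝒜 0, ∃ z ∈ 𝒜 1, y + z = x := by
  have : x ∈ 𝒜 0 ⊔ 𝒜 1 := by rw [h.isCompl.sup_eq_top]; trivial
  exact Submodule.mem_sup.1 this

/-- A statement about `x` that is additive may be checked on homogeneous elements. -/
theorem IsSuperalgebra.induction {𝒜 : ZMod 2 → Submodule k A} (h : IsSuperalgebra 𝒜)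
    {P : A → Prop} (hadd : ∀ x y, P x → P y → P (x + y))
    (hom : ∀ i, ∀ x ∈ 𝒜 i, P x) (x : A) : P x := by
  obtain ⟨y, hy, z, hz, rfl⟩ := h.exists_add x
  exact hadd _ _ (hom 0 y hy) (hom 1 z hz)

theorem IsSuperalgebra.isGraded_idealSpan {𝒜 : ZMod 2 → Submodule k A} (h : IsSuperalgebra 𝒜)
    {S : Set A} (hS : ∀ s ∈ S, s ∈ (idealSpan k S ⊓ 𝒜 0) ⊔ (idealSpan k S ⊓ 𝒜 1)) :
    IsGraded 𝒜 (idealSpan k S) := by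
  refine idealSpan_le k ?_ hS
  intro x y hy
  obtain ⟨y0, hy0, y1, hy1, rfl⟩ := Submodule.mem_sup.1 hy
  have hI := isIdeal_idealSpan k S
  have key : ∀ i, ∀ y ∈ idealSpan k S ⊓ 𝒜 i,
      x * y ∈ (idealSpan k S ⊓ 𝒜 0) ⊔ (idealSpan k S ⊓ 𝒜 1) ∧
      y * x ∈ (idealSpan k S ⊓ 𝒜 0) ⊔ (idealSpan k S ⊓ 𝒜 1) := by
    intro i y hy
    induction x using h.induction with
    | hadd a b ha hb =>
      rw [add_mul, mul_add]
      exact ⟨add_mem ha.1 hb.1, add_mem ha.2 hb.2⟩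
    | hom j a ha =>
      exact ⟨IsSuperalgebra.le_sup _ _ (hI a y hy.1).1 (h.mul_mem j i a y ha hy.2),
        IsSuperalgebra.le_sup _ _ (hI a y hy.1).2 (h.mul_mem i j y a hy.2 ha)⟩
  rw [add_mul, mul_add]
  exact ⟨add_mem (key 0 y0 hy0).1 (key 1 y1 hy1).1, add_mem (key 0 y0 hy0).2 (key 1 y1 hy1).2⟩

theorem IsSuperalgebra.quotient {𝒜 : ZMod 2 → Submodule k A} (h : IsSuperalgebra 𝒜)
    {S : Set A} (hS : IsGraded 𝒜 (idealSpan k S)) :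
    IsSuperalgebra fun i => (𝒜 i).map (QuotientAlgebra.proj k S) where
  isCompl := by
    refine ⟨?_, ?_⟩
    · rw [Submodule.disjoint_def]
      rintro _ ⟨a, ha, rfl⟩ ⟨b, hb, hab⟩
      rw [QuotientAlgebra.proj_eq_zero]
      have hI : a - b ∈ idealSpan k S := by
        rw [← QuotientAlgebra.proj_eq_zero, map_sub, hab, sub_self]
      obtain ⟨c, hc, d, hd, hcd⟩ := Submodule.mem_sup.1 (hS hI)
      have e : a - c = b + d := by
        rw [sub_eq_iff_eq_add, add_assoc, add_comm d c, hcd]; abel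
      have h0 : a - c = 0 := by
        refine (Submodule.disjoint_def.1 h.isCompl.disjoint) _ (sub_mem ha hc.2) ?_
        rw [e]; exact add_mem hb hd.2
      rw [sub_eq_zero.1 h0]; exact hc.1
    · rw [codisjoint_iff, ← Submodule.map_sup, h.isCompl.sup_eq_top, Submodule.map_top,
        LinearMap.range_eq_top]
      exact QuotientAlgebra.proj_surjective k S
  mul_mem := by
    rintro i j _ _ ⟨x, hx, rfl⟩ ⟨y, hy, rfl⟩
    exact ⟨x * y, h.mul_mem i j x y hx hy, rfl⟩

theorem IsLeibnizSuperalgebra.quotient {𝒜 : ZMod 2 → Submodule k A}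
    (h : IsLeibnizSuperalgebra 𝒜) {S : Set A} (hS : IsGraded 𝒜 (idealSpan k S)) :
    IsLeibnizSuperalgebra fun i => (𝒜 i).map (QuotientAlgebra.proj k S) where
  toIsSuperalgebra := h.toIsSuperalgebra.quotient hS
  leibniz := by
    rintro l i j _ _ _ ⟨x, hx, rfl⟩ ⟨y, hy, rfl⟩ ⟨z, hz, rfl⟩
    simp only [← QuotientAlgebra.proj_mul, ← map_smul, ← map_sub]
    rw [h.leibniz l i j x y z hx hy hz]

/-- A homomorphism that kills `S` factors through `A / Id(S)`. -/
theorem QuotientAlgebra.exists_lift {B : Type*} [NonUnitalNonAssocRing B] [Module k B] {S : Set A}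
    (φ : A →ₙₐ[k] B) (hφ : ∀ s ∈ S, φ s = 0) :
    ∃ ψ : QuotientAlgebra k S →ₙₐ[k] B, ∀ x, ψ (proj k S x) = φ x := by
  have hle : idealSpan k S ≤ LinearMap.ker (φ : A →ₗ[k] B) := by
    refine idealSpan_le k ?_ hφ
    intro x y hy
    have hy' : φ y = 0 := hy
    refine ⟨?_, ?_⟩
    · change φ (x * y) = 0
      rw [map_mul, hy', mul_zero]
    · change φ (y * x) = 0
      rw [map_mul, hy', zero_mul]
  let L : QuotientAlgebra k S →ₗ[k] B := (idealSpan k S).liftQ (φ : A →ₗ[k] B) hle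
  have hL : ∀ x, L (proj k S x) = φ x := fun x => rfl
  refine ⟨{ toFun := L, map_smul' := L.map_smul, map_zero' := L.map_zero, map_add' := L.map_add,
            map_mul' := ?_ }, hL⟩
  intro a b
  obtain ⟨a, rfl⟩ := proj_surjective k S a
  obtain ⟨b, rfl⟩ := proj_surjective k S b
  rw [← proj_mul, hL, hL, hL, map_mul]

end Superalgebras

section Free

variable (k : Type*) [Field k] {X : Type*} (p : X → ZMod 2)

theorem term_mul (u v : FreeMagma X) : term k X (u * v) = term k X u * term k X v :=
  map_mul (MonoidAlgebra.ofMagma k (FreeMagma X)) u v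

theorem parity_mul (u v : FreeMagma X) : parity p (u * v) = parity p u + parity p v := rfl

/-- The component of parity `i` of the free non-associative algebra. -/
def termGrading (i : ZMod 2) : Submodule k (FreeNonUnitalNonAssocAlgebra k X) :=
  Submodule.span k (term k X '' {u | parity p u = i})

theorem isSuperalgebra_termGrading : IsSuperalgebra (termGrading k p) where
  isCompl := by
    refine ⟨?_, ?_⟩
    · have key : ∀ i, ∀ x ∈ termGrading k p i,
          x.coeff ∈ Finsupp.supported k k {u | parity p u = i} := by
        intro i x hx
        induction hx using Submodule.span_induction with
        | mem x hx =>
          obtain ⟨u, hu, rfl⟩ := hx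
          exact Finsupp.single_mem_supported k 1 hu
        | zero => exact Submodule.zero_mem _
        | add x y _ _ hx hy => exact Submodule.add_mem _ hx hy
        | smul c x _ hx => exact Submodule.smul_mem _ c hx
      rw [Submodule.disjoint_def]
      intro x hx hy
      have hd : Disjoint {u : FreeMagma X | parity p u = 0} {u | parity p u = 1} := by
        rw [Set.disjoint_left]
        intro u (hu : parity p u = 0) (hv : parity p u = 1)
        rw [hu] at hv
        exact absurd hv (by decide)
      have := Submodule.disjoint_def.1
        (Finsupp.disjoint_supported_supported (R := k) (M := k) hd) _ (key 0 x hx) (key 1 x hy)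
      exact MonoidAlgebra.coeff_eq_zero.1 this
    · rw [codisjoint_iff, eq_top_iff]
      rintro x -
      induction x using MonoidAlgebra.induction_linear with
      | zero => exact Submodule.zero_mem _
      | add x y hx hy => exact Submodule.add_mem _ hx hy
      | single u c =>
        have e : MonoidAlgebra.single u c = c • term k X u := by
          simp [term]
        rw [e]
        refine Submodule.smul_mem _ _ ?_
        rcases parity_cases (parity p u) with h | h
        · exact Submodule.mem_sup_left (Submodule.subset_span ⟨u, h, rfl⟩)
        · exact Submodule.mem_sup_right (Submodule.subset_span ⟨u, h, rfl⟩)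
  mul_mem := by
    intro i j x y hx hy
    induction hx using Submodule.span_induction with
    | mem x hx =>
      obtain ⟨u, hu, rfl⟩ := hx
      induction hy using Submodule.span_induction with
      | mem y hy =>
        obtain ⟨v, hv, rfl⟩ := hy
        rw [← term_mul]
        refine Submodule.subset_span ⟨u * v, ?_, rfl⟩
        change parity p u + parity p v = i + j
        rw [show parity p u = i from hu, show parity p v = j from hv]
      | zero => rw [mul_zero]; exact Submodule.zero_mem _
      | add y z _ _ hy hz => rw [mul_add]; exact Submodule.add_mem _ hy hz
      | smul c y _ hy => rw [mul_smul_comm]; exact Submodule.smul_mem _ c hy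
    | zero => rw [zero_mul]; exact Submodule.zero_mem _
    | add y z _ _ hy hz => rw [add_mul]; exact Submodule.add_mem _ hy hz
    | smul c y _ hy => rw [smul_mul_assoc]; exact Submodule.smul_mem _ c hy

theorem FreeLeibniz.isLeibnizSuperalgebra : IsLeibnizSuperalgebra (grading k p) where
  toIsSuperalgebra := by
    refine (isSuperalgebra_termGrading k p).quotient
      ((isSuperalgebra_termGrading k p).isGraded_idealSpan ?_)
    rintro _ ⟨u, v, w, rfl⟩
    refine IsSuperalgebra.le_sup _ (parity p (u * (v * w)))
      (subset_idealSpan k _ ⟨u, v, w, rfl⟩) ?_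
    refine add_mem (sub_mem ?_ ?_) (Submodule.smul_mem _ _ ?_) <;>
      refine Submodule.subset_span ⟨_, ?_, rfl⟩ <;>
      simp only [Set.mem_ofPred_eq, parity_mul] <;> abel
  leibniz := by
    rintro h i j _ _ _ ⟨x, hx, rfl⟩ ⟨y, hy, rfl⟩ ⟨z, hz, rfl⟩
    simp only [← QuotientAlgebra.proj_mul, ← map_smul, ← map_sub]
    induction hx using Submodule.span_induction with
    | zero => simp
    | add a b _ _ ha hb =>
      simp only [add_mul, smul_add, map_add, map_sub] at ha hb ⊢
      rw [ha, hb]; abel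
    | smul c a _ ha =>
      simp only [smul_mul_assoc, map_smul, map_sub] at ha ⊢
      rw [ha, smul_sub, smul_comm c]
    | mem x hx =>
    induction hy using Submodule.span_induction with
    | zero => simp
    | add a b _ _ ha hb =>
      simp only [add_mul, mul_add, smul_add, map_add, map_sub] at ha hb ⊢
      rw [ha, hb]; abel
    | smul c a _ ha =>
      simp only [smul_mul_assoc, mul_smul_comm, map_smul, map_sub] at ha ⊢
      rw [ha, smul_sub, smul_comm c]
    | mem y hy =>
    induction hz using Submodule.span_induction with
    | zero => simp
    | add a b _ _ ha hb =>
      simp only [add_mul, mul_add, smul_add, map_add, map_sub] at ha hb ⊢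
      rw [ha, hb]; abel
    | smul c a _ ha =>
      simp only [smul_mul_assoc, mul_smul_comm, map_smul, map_sub] at ha ⊢
      rw [ha, smul_sub, smul_comm c]
    | mem z hz =>
      obtain ⟨u, hu, rfl⟩ := hx
      obtain ⟨v, hv, rfl⟩ := hy
      obtain ⟨w, hw, rfl⟩ := hz
      rw [← sub_eq_zero, ← map_sub, QuotientAlgebra.proj_eq_zero]
      refine subset_idealSpan k _ ⟨u, v, w, ?_⟩
      simp only [term_mul]
      rw [show parity p v = i from hv, show parity p w = j from hw, sgn, sgn, mul_comm j.val]
      abel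

theorem FreeLeibniz.gen_mem (x : X) : gen k p x ∈ grading k p (p x) :=
  ⟨_, Submodule.subset_span ⟨.of x, rfl, rfl⟩, rfl⟩

/-- `Lbs(X)` has the universal property of the free Leibniz superalgebra. -/
theorem FreeLeibniz.existsUnique_lift {B : Type*} [NonUnitalNonAssocRing B] [Module k B]
    [IsScalarTower k B B] [SMulCommClass k B B] {ℬ : ZMod 2 → Submodule k B}
    (hℬ : IsLeibnizSuperalgebra ℬ) (f : X → B) (hf : ∀ x, f x ∈ ℬ (p x)) :
    ∃! φ : FreeLeibniz k p →ₙₐ[k] B,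
      (∀ i, ∀ x ∈ grading k p i, φ x ∈ ℬ i) ∧ ∀ x, φ (gen k p x) = f x := by
  let Φ := FreeNonUnitalNonAssocAlgebra.lift k f
  have hgen : ∀ x, Φ (term k X (.of x)) = f x := FreeNonUnitalNonAssocAlgebra.lift_of_apply k f
  have hΦ : ∀ u, Φ (term k X u) ∈ ℬ (parity p u) := by
    intro u
    induction u with
    | ih1 x => rw [hgen]; exact hf x
    | ih2 u v hu hv => rw [term_mul, map_mul]; exact hℬ.mul_mem _ _ _ _ hu hv
  obtain ⟨φ, hφ⟩ := QuotientAlgebra.exists_lift (S := leibnizRelators k p) Φ (by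
    rintro _ ⟨u, v, w, rfl⟩
    simp only [map_add, map_sub, map_smul, term_mul, map_mul]
    rw [hℬ.leibniz _ _ _ _ _ _ (hΦ u) (hΦ v) (hΦ w), sgn, sgn, mul_comm (parity p w).val]
    abel)
  refine ⟨φ, ⟨?_, fun x => (hφ _).trans (hgen x)⟩, ?_⟩
  · rintro i _ ⟨x, hx, rfl⟩
    rw [hφ]
    induction hx using Submodule.span_induction with
    | mem x hx => obtain ⟨u, rfl, rfl⟩ := hx; exact hΦ u
    | zero => rw [map_zero]; exact Submodule.zero_mem _
    | add a b _ _ ha hb => rw [map_add]; exact Submodule.add_mem _ ha hb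
    | smul c a _ ha => rw [map_smul]; exact Submodule.smul_mem _ c ha
  · rintro ψ ⟨-, hψ⟩
    let π : FreeNonUnitalNonAssocAlgebra k X →ₙₐ[k] FreeLeibniz k p :=
      { toFun := QuotientAlgebra.proj k _, map_smul' := map_smul _, map_zero' := map_zero _,
        map_add' := map_add _, map_mul' := QuotientAlgebra.proj_mul k _ }
    have : ψ.comp π = Φ := FreeNonUnitalNonAssocAlgebra.hom_ext k fun x =>
      (hψ x).trans (hgen x).symm
    ext a
    obtain ⟨a, rfl⟩ := QuotientAlgebra.proj_surjective k _ a
    rw [hφ, ← this]; rfl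

theorem FreeMetabelian.isLeibnizSuperalgebra : IsLeibnizSuperalgebra (grading k p) := by
  have hL := FreeLeibniz.isLeibnizSuperalgebra k p
  refine hL.quotient (hL.toIsSuperalgebra.isGraded_idealSpan ?_)
  rintro _ ⟨a, b, c, d, rfl⟩
  induction a using hL.toIsSuperalgebra.induction with
  | hadd x y hx hy => rw [add_mul, add_mul]; exact add_mem hx hy
  | hom i a ha =>
  induction b using hL.toIsSuperalgebra.induction with
  | hadd x y hx hy => rw [mul_add, add_mul]; exact add_mem hx hy
  | hom j b hb =>
  induction c using hL.toIsSuperalgebra.induction with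
  | hadd x y hx hy => rw [add_mul, mul_add]; exact add_mem hx hy
  | hom l c hc =>
  induction d using hL.toIsSuperalgebra.induction with
  | hadd x y hx hy => rw [mul_add, mul_add]; exact add_mem hx hy
  | hom m d hd =>
    exact IsSuperalgebra.le_sup _ ((i + j) + (l + m)) (subset_idealSpan k _ ⟨a, b, c, d, rfl⟩)
      (hL.mul_mem _ _ _ _ (hL.mul_mem _ _ _ _ ha hb) (hL.mul_mem _ _ _ _ hc hd))

theorem FreeMetabelian.gen_mem (x : X) : gen k p x ∈ grading k p (p x) :=
  ⟨_, FreeLeibniz.gen_mem k p x, rfl⟩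

/-- `MLbs(X)` is metabelian. -/
theorem FreeMetabelian.isMetabelian : IsMetabelian (grading k p) := by
  have hM := (FreeMetabelian.isLeibnizSuperalgebra k p).toIsSuperalgebra
  have hmem : ∀ x y : FreeMetabelian k p,
      x * y ∈ Submodule.span k {z : FreeMetabelian k p | ∃ a b, z = a * b} :=
    fun x y => Submodule.subset_span ⟨x, y, rfl⟩
  refine ⟨Submodule.span k {z | ∃ a b, z = a * b}, fun x y _ => ⟨hmem _ _, hmem _ _⟩, ?_, ?_,
    hmem⟩
  · refine Submodule.span_le.2 ?_
    rintro _ ⟨a, b, rfl⟩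
    change a * b ∈ (_ : Submodule k (FreeMetabelian k p))
    induction a using hM.induction with
    | hadd x y hx hy => rw [add_mul]; exact add_mem hx hy
    | hom i a ha =>
    induction b using hM.induction with
    | hadd x y hx hy => rw [mul_add]; exact add_mem hx hy
    | hom j b hb => exact IsSuperalgebra.le_sup _ (i + j) (hmem _ _) (hM.mul_mem _ _ _ _ ha hb)
  · intro x hx y hy
    induction hx using Submodule.span_induction with
    | zero => rw [zero_mul]
    | add a b _ _ ha hb => rw [add_mul, ha, hb, add_zero]
    | smul c a _ ha => rw [smul_mul_assoc, ha, smul_zero]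
    | mem x hx =>
    induction hy using Submodule.span_induction with
    | zero => rw [mul_zero]
    | add a b _ _ ha hb => rw [mul_add, ha, hb, add_zero]
    | smul c a _ ha => rw [mul_smul_comm, ha, smul_zero]
    | mem y hy =>
      obtain ⟨a, b, rfl⟩ := hx
      obtain ⟨c, d, rfl⟩ := hy
      obtain ⟨a, rfl⟩ := QuotientAlgebra.proj_surjective k _ a
      obtain ⟨b, rfl⟩ := QuotientAlgebra.proj_surjective k _ b
      obtain ⟨c, rfl⟩ := QuotientAlgebra.proj_surjective k _ c
      obtain ⟨d, rfl⟩ := QuotientAlgebra.proj_surjective k _ d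
      simp only [← QuotientAlgebra.proj_mul]
      rw [QuotientAlgebra.proj_eq_zero]
      exact subset_idealSpan k _ ⟨a, b, c, d, rfl⟩

/-- `MLbs(X)` has the universal property of the free metabelian Leibniz superalgebra. -/
theorem FreeMetabelian.existsUnique_lift {B : Type*} [NonUnitalNonAssocRing B] [Module k B]
    [IsScalarTower k B B] [SMulCommClass k B B] {ℬ : ZMod 2 → Submodule k B}
    (hℬ : IsLeibnizSuperalgebra ℬ) (hmet : IsMetabelian ℬ) (f : X → B)
    (hf : ∀ x, f x ∈ ℬ (p x)) :
    ∃! φ : FreeMetabelian k p →ₙₐ[k] B,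
      (∀ i, ∀ x ∈ grading k p i, φ x ∈ ℬ i) ∧ ∀ x, φ (gen k p x) = f x := by
  obtain ⟨Φ, ⟨hΦ, hgen⟩, huniq⟩ := FreeLeibniz.existsUnique_lift k p hℬ f hf
  obtain ⟨N, -, -, hN, hN'⟩ := hmet
  obtain ⟨φ, hφ⟩ := QuotientAlgebra.exists_lift (S := metabelianRelators k p) Φ (by
    rintro _ ⟨a, b, c, d, rfl⟩
    rw [map_mul, map_mul, map_mul]
    exact hN _ (hN' _ _) _ (hN' _ _))
  refine ⟨φ, ⟨?_, fun x => (hφ _).trans (hgen x)⟩, ?_⟩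
  · rintro i _ ⟨x, hx, rfl⟩
    rw [hφ]; exact hΦ i x hx
  · rintro ψ ⟨hψ, hψ'⟩
    let π : FreeLeibniz k p →ₙₐ[k] FreeMetabelian k p :=
      { toFun := QuotientAlgebra.proj k _, map_smul' := map_smul _, map_zero' := map_zero _,
        map_add' := map_add _, map_mul' := QuotientAlgebra.proj_mul k _ }
    have : ψ.comp π = Φ := huniq _ ⟨fun i x hx => hψ i _ ⟨x, hx, rfl⟩, hψ'⟩
    ext a
    obtain ⟨a, rfl⟩ := QuotientAlgebra.proj_surjective k _ a
    rw [hφ, ← this]; rfl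

end Free

/-! ### Left-normed words and the deg-length-lex order -/

section Words

/-- The left-normed product `[f a₁ ⋯ aₙ] = ((⋯((f a₁) a₂)⋯) aₙ)`. -/
def leftNormed {A : Type*} [Mul A] (f : A) (l : List A) : A := l.foldl (· * ·) f

variable {X : Type*}

/-- The list of letters of a nonempty associative word. -/
def letters (w : FreeSemigroup X) : List X := w.head :: w.tail

/-- The degree of a word, for given degrees of the letters. -/
def degree (deg : X → ℕ+) (w : FreeSemigroup X) : ℕ :=
  ((letters w).map fun x => (deg x : ℕ)).sum

/-- The deg-length-lex order on words: words are compared first by degree, then by length, then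
lexicographically from the left. -/
def wordLT [LinearOrder X] (deg : X → ℕ+) (v w : FreeSemigroup X) : Prop :=
  degree deg v < degree deg w ∨ degree deg v = degree deg w ∧
    (v.length < w.length ∨ v.length = w.length ∧ List.Lex (· < ·) (letters v) (letters w))

variable (k : Type*) [Field k] (p : X → ZMod 2)

/-- The element `[a₁ ⋯ aₙ]` of `Lbs(X)` for the word `w = a₁ ⋯ aₙ`. These elements form
the set `NF(X)`. -/
def FreeLeibniz.word (w : FreeSemigroup X) : FreeLeibniz k p :=
  leftNormed (FreeLeibniz.gen k p w.head) (w.tail.map (FreeLeibniz.gen k p))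

/-- The element `[a₁ ⋯ aₙ]` of `MLbs(X)` for the word `w = a₁ ⋯ aₙ`. -/
def FreeMetabelian.word (w : FreeSemigroup X) : FreeMetabelian k p :=
  leftNormed (FreeMetabelian.gen k p w.head) (w.tail.map (FreeMetabelian.gen k p))

end Words

/-! ### Gröbner–Shirshov bases in the free Leibniz superalgebra -/

section GroebnerShirshov

variable {k : Type*} [Field k] {X : Type*} [LinearOrder X] {p : X → ZMod 2} (deg : X → ℕ+)

open FreeLeibniz

/-- The leading monomial of `f ∈ Lbs(X)` is `[w]`, with coefficient `c`: `c ≠ 0`, and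
`f - c [w]` is a linear combination of left-normed words `[v]` with `v < w`. -/
def HasLeadingTerm (f : FreeLeibniz k p) (w : FreeSemigroup X) (c : k) : Prop :=
  c ≠ 0 ∧ f - c • word k p w ∈ Submodule.span k (word k p '' {v | wordLT deg v w})

/-- The leading monomial of `f` is `[w]`. -/
def HasLeadingMonomial (f : FreeLeibniz k p) (w : FreeSemigroup X) : Prop :=
  ∃ c : k, HasLeadingTerm deg f w c

/-- `f` is monic: its leading coefficient is `1`. -/
def IsMonic (f : FreeLeibniz k p) : Prop := ∃ w, HasLeadingTerm deg f w 1

/-- `f` is homogeneous (with respect to parity). -/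
def IsHomogeneous (f : FreeLeibniz k p) : Prop := ∃ i, f ∈ grading k p i

/-- `h` is a normal polynomial built from `s`: `h = [s a₁ ⋯ aₘ]` with `m ≥ 0`, or
`h = [a₁ ⋯ aₜ s aₜ₊₁ ⋯ aₘ]` with `1 ≤ t ≤ m`, the latter only if the leading
monomial of `s` has length one. -/
def IsNormalOf (s h : FreeLeibniz k p) : Prop :=
  (∃ l : List X, h = leftNormed s (l.map (gen k p))) ∨
  ((∃ x : X, HasLeadingMonomial deg s (FreeSemigroup.of x)) ∧
    ∃ (u : FreeSemigroup X) (l : List X),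
      h = leftNormed (word k p u) (s :: l.map (gen k p)))

/-- `h` is a normal `S`-polynomial. -/
def IsNormalPoly (S : Set (FreeLeibniz k p)) (h : FreeLeibniz k p) : Prop :=
  ∃ s ∈ S, IsNormalOf deg s h

/-- `f ≡ 0 mod (S, w)`: `f` is a linear combination of normal `S`-polynomials whose leading
monomials are smaller than `w`. -/
def TrivialModWord (S : Set (FreeLeibniz k p)) (w : FreeSemigroup X) (f : FreeLeibniz k p) :
    Prop :=
  f ∈ Submodule.span k
    {h | IsNormalPoly deg S h ∧ ∃ v, HasLeadingMonomial deg h v ∧ wordLT deg v w}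

/-- `f ≡ 0 mod (S, n)`: `f` is a linear combination of normal `S`-polynomials whose leading
monomials have degree at most `n`. -/
def TrivialModDegree (S : Set (FreeLeibniz k p)) (n : ℕ) (f : FreeLeibniz k p) : Prop :=
  f ∈ Submodule.span k
    {h | IsNormalPoly deg S h ∧ ∃ v, HasLeadingMonomial deg h v ∧ degree deg v ≤ n}

/-- `S` is a Gröbner–Shirshov basis in `Lbs(X)`: a monic homogeneous set whose left
multiplication compositions `[u] f` and inclusion compositions `f - h_g` are trivial. -/
structure IsGroebnerShirshovBasis (S : Set (FreeLeibniz k p)) : Prop where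
  monic : ∀ f ∈ S, IsMonic deg f
  homogeneous : ∀ f ∈ S, IsHomogeneous f
  left_multiplication : ∀ f ∈ S, ∀ w : FreeSemigroup X, HasLeadingMonomial deg f w →
    1 < w.length → ∀ u : FreeSemigroup X, word k p u * f ≠ 0 →
      TrivialModDegree deg S (degree deg u + degree deg w) (word k p u * f)
  inclusion : ∀ f ∈ S, ∀ g ∈ S, f ≠ g → ∀ w : FreeSemigroup X, HasLeadingMonomial deg f w →
    ∀ h : FreeLeibniz k p, IsNormalOf deg g h → HasLeadingMonomial deg h w →
      TrivialModWord deg S w (f - h)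

end GroebnerShirshov

/-! ### The sets `S₁` and `S'` -/

section Relations

variable (k : Type*) [Field k] {X : Type*} [LinearOrder X] (p : X → ZMod 2)

open FreeLeibniz

/-- `S₁`: the elements `[c₁ ⋯ c_q a b] - (-1)^{|a||b|} [c₁ ⋯ c_q b a]` with `q ≥ 2`, `b < a`. -/
def relS₁ : Set (FreeLeibniz k p) :=
  {f | ∃ (c : FreeSemigroup X) (a b : X), 2 ≤ c.length ∧ b < a ∧
    f = word k p (c * .of a * .of b) - sgn k (p a) (p b) • word k p (c * .of b * .of a)}

/-- `S₂`: the elements `[c₁ ⋯ c_q a a]` with `q ≥ 2` and `a` odd. -/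
def relS₂ : Set (FreeLeibniz k p) :=
  {f | ∃ (c : FreeSemigroup X) (a : X), 2 ≤ c.length ∧ p a = 1 ∧
    f = word k p (c * .of a * .of a)}

/-- `S' = S₁ ∪ S₂`. -/
def relS' : Set (FreeLeibniz k p) := relS₁ k p ∪ relS₂ k p

/-- The words `a₁ ⋯ aₙ` with `a₃ ≤ a₄ ≤ ⋯ ≤ aₙ`. -/
def IsTailSorted (w : FreeSemigroup X) : Prop :=
  ((letters w).drop 2).IsChain (· ≤ ·)

/-- For all `j ≥ 3`, if `aⱼ` is odd then `aⱼ ≠ aⱼ₊₁`. -/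
def NoOddRepeat (w : FreeSemigroup X) : Prop :=
  ((letters w).drop 2).IsChain fun a b => p a = 1 → a ≠ b

/-- The elements `v i` form a linear basis of `V`. -/
def IsLinearBasis {ι V : Type*} [AddCommGroup V] [Module k V] (v : ι → V) : Prop :=
  LinearIndependent k v ∧ Submodule.span k (Set.range v) = ⊤

end Relations

end LeibnizSuper

end

open LeibnizSuper

/-! The Leibniz identity expresses right multiplication by a product through right multiplications
by its factors, so left-normed words span `Lbs(X)`. They are independent because `x ↦ (x, x)`
extends to the superalgebra with product `(m, a)(n, b) = (m b, [a, b])`, where the first coordinate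
of a left-normed word is the associative word itself (`linearIndependent_word`).

Both characteristics are treated at once by `swapRel`, which is `S₁` if `2 = 0` in `k` and `S'`
otherwise. Up to a nonzero scalar, each relation is `[c](ab)` with `c` of length at least two, a
product of two products. Conversely, every product of two products is a combination of the elements
`[s a₁ ⋯ aₘ]` with `s` a relation (`mul_mul_mul_mem_swapSpan`). Hence the span `swapSpan` of these
elements is an ideal, and it equals both `Id(swapRel)` and `I`.

Modulo `I` the letters from the third on supercommute. The linear map `normalForm` therefore records
the first two letters and the multiset of the others, with a sign, or with `0` if an odd letter
repeats there and `2 ≠ 0`. It kills the ideal and sends normal words to distinct basis vectors, so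
no nonzero combination of normal words lies in the ideal (`eq_zero_of_mem_swapSpan`).

Finally, rewriting reducible pairs writes any word as normal words plus normal polynomials with no
larger leading monomial (`word_mem_normal_sup`). For an element of the ideal the normal part must
vanish, so it is a combination of normal polynomials bounded by its own monomials. All compositions
lie in the ideal, so this settles them without a study of overlaps; the same two facts give the
basis of `MLbs(X)`. -/

noncomputable section

namespace LeibnizSuper

open FreeLeibniz

/-! ### Sign rules for parities. -/

section Signs

variable (k : Type*) [Field k]

theorem sgn_comm (i j : ZMod 2) : sgn k i j = sgn k j i := by
  rw [sgn, sgn, mul_comm]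

theorem sgn_mul_self (i j : ZMod 2) : sgn k i j * sgn k i j = 1 := by
  rw [sgn, ← mul_pow]; simp

@[simp] theorem sgn_zero_left (j : ZMod 2) : sgn k 0 j = 1 := by simp [sgn]

@[simp] theorem sgn_zero_right (j : ZMod 2) : sgn k j 0 = 1 := by simp [sgn]

@[simp] theorem sgn_one_one : sgn k 1 1 = -1 := by simp [sgn, ZMod.val_one]

end Signs

/-! ### Nonempty words and induction on the last letter. -/

section Words

variable {X : Type*}

/-- The word `w` followed by the letters of `l`. -/
def appendWord (w : FreeSemigroup X) (l : List X) : FreeSemigroup X := ⟨w.head, w.tail ++ l⟩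

theorem letters_appendWord (w : FreeSemigroup X) (l : List X) :
    letters (appendWord w l) = letters w ++ l := rfl

theorem letters_injective : Function.Injective (letters (X := X)) := by
  rintro ⟨a, l⟩ ⟨b, m⟩ h
  simpa [letters] using h

theorem length_letters (w : FreeSemigroup X) : (letters w).length = w.length := rfl

theorem letters_mul (v w : FreeSemigroup X) : letters (v * w) = letters v ++ letters w := rfl

theorem letters_of (x : X) : letters (FreeSemigroup.of x) = [x] := rfl

theorem length_appendWord (w : FreeSemigroup X) (l : List X) :
    (appendWord w l).length = w.length + l.length := by
  simp [← length_letters, letters_appendWord]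

theorem word_induction {P : FreeSemigroup X → Prop} (of : ∀ x, P (.of x))
    (snoc : ∀ w x, P w → P (w * .of x)) (w : FreeSemigroup X) : P w := by
  obtain ⟨a, l⟩ := w
  induction l using List.reverseRecOn with
  | nil => exact of a
  | append_singleton l x ih => exact snoc ⟨a, l⟩ x ih

/-- The parity of a list of letters. -/
def listParity (p : X → ZMod 2) (l : List X) : ZMod 2 := (l.map p).sum

end Words

/-! ### Left-normed words span `Lbs(X)`. -/

section Span

variable (k : Type*) [Field k] {X : Type*} (p : X → ZMod 2)

theorem word_of (x : X) : word k p (.of x) = gen k p x := rfl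

theorem leftNormed_word (w : FreeSemigroup X) (l : List X) :
    leftNormed (word k p w) (l.map (gen k p)) = word k p (appendWord w l) := by
  simp [word, leftNormed, appendWord]

theorem word_mul_gen (w : FreeSemigroup X) (x : X) :
    word k p w * gen k p x = word k p (w * .of x) := leftNormed_word k p w [x]

theorem leibniz_of_mem {i j : ZMod 2} (x : FreeLeibniz k p) {y z : FreeLeibniz k p}
    (hy : y ∈ grading k p i) (hz : z ∈ grading k p j) :
    x * (y * z) = (x * y) * z - sgn k j i • ((x * z) * y) := by
  have hL := FreeLeibniz.isLeibnizSuperalgebra k p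
  induction x using hL.toIsSuperalgebra.induction with
  | hadd a b ha hb => simp only [add_mul, ha, hb, smul_add]; abel
  | hom h x hx => exact hL.leibniz h i j x y z hx hy hz

theorem word_mem_grading (w : FreeSemigroup X) :
    word k p w ∈ grading k p (listParity p (letters w)) := by
  induction w using word_induction with
  | of x => simpa [listParity, letters_of, word_of] using FreeLeibniz.gen_mem k p x
  | snoc w x ih =>
    rw [← word_mul_gen]
    simpa [listParity, letters_mul, letters_of] using
      (FreeLeibniz.isLeibnizSuperalgebra k p).mul_mem _ _ _ _ ih (FreeLeibniz.gen_mem k p x)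

theorem mul_word_snoc (f : FreeLeibniz k p) (w : FreeSemigroup X) (x : X) :
    f * word k p (w * .of x) = (f * word k p w) * gen k p x
      - sgn k (p x) (listParity p (letters w)) • ((f * gen k p x) * word k p w) := by
  rw [← word_mul_gen]
  exact leibniz_of_mem k p f (word_mem_grading k p w) (FreeLeibniz.gen_mem k p x)

/-- The Leibniz identity splits off the last letter of the right factor and preserves total length.
One of the two resulting terms multiplies the longer word `u x` by `v`, so the induction on `v` has
to run over all `u`. -/
theorem word_mul_word_mem (u v : FreeSemigroup X) :
    word k p u * word k p v ∈
      Submodule.span k (word k p '' {w | w.length = u.length + v.length}) := by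
  induction v using word_induction generalizing u with
  | of x =>
    rw [word_of, word_mul_gen]
    exact Submodule.subset_span ⟨_, by simp [FreeSemigroup.length_mul, FreeSemigroup.length_of], rfl⟩
  | snoc v x ih =>
    rw [mul_word_snoc]
    refine sub_mem ?_ (Submodule.smul_mem _ _ ?_)
    · have h := ih u
      generalize word k p u * word k p v = f at h ⊢
      induction h using Submodule.span_induction with
      | zero => rw [zero_mul]; exact Submodule.zero_mem _
      | add a b _ _ ha hb => rw [add_mul]; exact add_mem ha hb
      | smul c a _ ha => rw [smul_mul_assoc]; exact Submodule.smul_mem _ _ ha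
      | mem a ha =>
        obtain ⟨w, hw, rfl⟩ := ha
        rw [word_mul_gen]
        refine Submodule.subset_span ⟨_, ?_, rfl⟩
        simp only [Set.mem_ofPred_eq, FreeSemigroup.length_mul, FreeSemigroup.length_of] at hw ⊢
        omega
    · rw [word_mul_gen]
      convert ih (u * .of x) using 4
      simp only [FreeSemigroup.length_mul, FreeSemigroup.length_of]
      congr! 1
      omega

/-- Right multiplication by a word is a combination of composites of right multiplications by
letters, so stability under letters suffices for a right ideal. -/
theorem mul_word_mem {J : Submodule k (FreeLeibniz k p)}
    (hJ : ∀ f ∈ J, ∀ x, f * gen k p x ∈ J) {f : FreeLeibniz k p} (hf : f ∈ J)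
    (w : FreeSemigroup X) : f * word k p w ∈ J := by
  induction w using word_induction generalizing f with
  | of x => exact hJ f hf x
  | snoc w x ih =>
    rw [mul_word_snoc]
    exact sub_mem (hJ _ (ih hf) x) (Submodule.smul_mem _ _ (ih (hJ f hf x)))

theorem mul_mem_of_mem_span_word {J : Submodule k (FreeLeibniz k p)}
    (hJ : ∀ f ∈ J, ∀ x, f * gen k p x ∈ J) {f g : FreeLeibniz k p} (hf : f ∈ J)
    (hg : g ∈ Submodule.span k (Set.range (word k p))) : f * g ∈ J := by
  induction hg using Submodule.span_induction with
  | zero => rw [mul_zero]; exact Submodule.zero_mem _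
  | add a b _ _ ha hb => rw [mul_add]; exact add_mem ha hb
  | smul c a _ ha => rw [mul_smul_comm]; exact Submodule.smul_mem _ _ ha
  | mem a ha => obtain ⟨w, rfl⟩ := ha; exact mul_word_mem k p hJ hf w

theorem span_word_mul_gen (f : FreeLeibniz k p)
    (hf : f ∈ Submodule.span k (Set.range (word k p))) (x : X) :
    f * gen k p x ∈ Submodule.span k (Set.range (word k p)) := by
  induction hf using Submodule.span_induction with
  | zero => rw [zero_mul]; exact Submodule.zero_mem _
  | add a b _ _ ha hb => rw [add_mul]; exact add_mem ha hb
  | smul c a _ ha => rw [smul_mul_assoc]; exact Submodule.smul_mem _ _ ha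
  | mem a ha =>
    obtain ⟨w, rfl⟩ := ha
    rw [word_mul_gen]
    exact Submodule.subset_span ⟨_, rfl⟩

/-- The left-normed words span `Lbs(X)`. -/
theorem span_range_word : Submodule.span k (Set.range (word k p)) = ⊤ := by
  rw [eq_top_iff]
  rintro f -
  obtain ⟨f, rfl⟩ := QuotientAlgebra.proj_surjective k _ f
  induction f using MonoidAlgebra.induction_linear with
  | zero => rw [map_zero]; exact Submodule.zero_mem _
  | add a b ha hb => rw [map_add]; exact add_mem ha hb
  | single u c =>
    have e : MonoidAlgebra.single u c = c • term k X u := by simp [term]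
    rw [e, map_smul]
    refine Submodule.smul_mem _ _ ?_
    induction u with
    | ih1 x => exact Submodule.subset_span ⟨.of x, rfl⟩
    | ih2 u v hu hv =>
      rw [term_mul, QuotientAlgebra.proj_mul]
      -- The span of the words itself plays the role of the stable subspace `J`.
      exact mul_mem_of_mem_span_word k p (span_word_mul_gen k p)
        (hu (by simp [term])) (hv (by simp [term]))

theorem mul_mem_of_mul_gen_mem {J : Submodule k (FreeLeibniz k p)}
    (hJ : ∀ f ∈ J, ∀ x, f * gen k p x ∈ J) {f : FreeLeibniz k p} (hf : f ∈ J)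
    (g : FreeLeibniz k p) : f * g ∈ J :=
  mul_mem_of_mem_span_word k p hJ hf (by rw [span_range_word]; trivial)

end Span

/-! ### A model of `Lbs(X)` -/

section Model

variable (k : Type*) [Field k] {X : Type*} (p : X → ZMod 2)

/-- The projection of the free associative algebra onto its odd component. -/
def oddPart : MonoidAlgebra k (FreeMonoid X) →ₗ[k] MonoidAlgebra k (FreeMonoid X) :=
  Finsupp.linearCombination k
    (fun w => MonoidAlgebra.single w ((listParity p w.toList).val : k)) ∘ₗ
    (MonoidAlgebra.coeffLinearEquiv k).toLinearMap

theorem oddPart_single (w : FreeMonoid X) (c : k) :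
    oddPart k p (MonoidAlgebra.single w c) =
      MonoidAlgebra.single w (c * (listParity p w.toList).val) := by
  simp [oddPart, MonoidAlgebra.coeffLinearEquiv]

theorem val_add_parity (i j : ZMod 2) :
    ((i + j).val : k) = i.val + j.val - 2 * (i.val * j.val) := by
  rcases parity_cases i with rfl | rfl <;> rcases parity_cases j with rfl | rfl <;>
    simp [ZMod.val_one]
  · rw [show (1 : ZMod 2) + 1 = 0 from rfl]; simp; ring

/-- On a monomial the projection is multiplication by its parity `0` or `1`, and for such numbers
the parity of a sum is `i + j - 2ij`. -/
theorem oddPart_mul (a b : MonoidAlgebra k (FreeMonoid X)) :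
    oddPart k p (a * b) = oddPart k p a * b + a * oddPart k p b
      - (2 : k) • (oddPart k p a * oddPart k p b) := by
  induction a using MonoidAlgebra.induction_linear with
  | zero => simp
  | add a a' ha ha' => simp only [add_mul, map_add, ha, ha', smul_add]; abel
  | single u c =>
    induction b using MonoidAlgebra.induction_linear with
    | zero => simp
    | add a a' ha ha' => simp only [mul_add, map_add, ha, ha', smul_add]; abel
    | single v d =>
      simp only [oddPart_single, MonoidAlgebra.single_mul_single, MonoidAlgebra.smul_single,
        ← MonoidAlgebra.single_add, ← MonoidAlgebra.single_sub, listParity,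
        FreeMonoid.toList_mul, List.map_append, List.sum_append, val_add_parity, smul_eq_mul]
      congr 1
      ring

/-- The sum of the free associative algebra with supercommutator and of its regular right
module, as a Leibniz superalgebra: `(m, a) (n, b) = (m b, [a, b])`. -/
def Hemisemidirect (_ : X → ZMod 2) : Type _ :=
  MonoidAlgebra k (FreeMonoid X) × MonoidAlgebra k (FreeMonoid X)

namespace Hemisemidirect

instance : AddCommGroup (Hemisemidirect k p) :=
  inferInstanceAs (AddCommGroup (MonoidAlgebra k (FreeMonoid X) × MonoidAlgebra k (FreeMonoid X)))

instance : Module k (Hemisemidirect k p) :=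
  inferInstanceAs (Module k (MonoidAlgebra k (FreeMonoid X) × MonoidAlgebra k (FreeMonoid X)))

/-- The supercommutator of the free associative algebra. -/
def bracket (a b : MonoidAlgebra k (FreeMonoid X)) : MonoidAlgebra k (FreeMonoid X) :=
  a * b - b * a + (2 : k) • (oddPart k p b * oddPart k p a)

instance : Mul (Hemisemidirect k p) := ⟨fun x y => (x.1 * y.2, bracket k p x.2 y.2)⟩

instance : NonUnitalNonAssocRing (Hemisemidirect k p) where
  left_distrib x y z := by
    refine Prod.ext (mul_add _ _ _) ?_
    change bracket k p x.2 (y.2 + z.2) = bracket k p x.2 y.2 + bracket k p x.2 z.2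
    simp only [bracket, mul_add, add_mul, map_add, smul_add]; abel
  right_distrib x y z := by
    refine Prod.ext (add_mul _ _ _) ?_
    change bracket k p (x.2 + y.2) z.2 = bracket k p x.2 z.2 + bracket k p y.2 z.2
    simp only [bracket, mul_add, add_mul, map_add, smul_add]; abel
  zero_mul x := by
    refine Prod.ext (zero_mul _) ?_
    change bracket k p 0 x.2 = 0
    simp [bracket]
  mul_zero x := by
    refine Prod.ext (mul_zero _) ?_
    change bracket k p x.2 0 = 0
    simp [bracket]

instance : IsScalarTower k (Hemisemidirect k p) (Hemisemidirect k p) where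
  smul_assoc c x y := by
    refine Prod.ext (smul_mul_assoc c x.1 y.2) ?_
    change bracket k p (c • x.2) y.2 = c • bracket k p x.2 y.2
    simp only [bracket, map_smul, smul_mul_assoc, mul_smul_comm, smul_add, smul_sub]
    rw [smul_comm]

instance : SMulCommClass k (Hemisemidirect k p) (Hemisemidirect k p) where
  smul_comm c x y := by
    refine Prod.ext (mul_smul_comm c x.1 y.2).symm ?_
    change c • bracket k p x.2 y.2 = bracket k p x.2 (c • y.2)
    simp only [bracket, map_smul, smul_mul_assoc, mul_smul_comm, smul_add, smul_sub]
    rw [smul_comm]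

/-- The second component of `x` is homogeneous of parity `i`. -/
def HasParity (x : Hemisemidirect k p) (i : ZMod 2) : Prop :=
  oddPart k p x.2 = (i.val : k) • x.2

variable {k p}

/-- The correction `2 b₁ a₁` in the bracket turns `-ba` into `+ba` exactly when both factors are
odd. Writing it with `oddPart` makes the bracket bilinear on all elements. -/
theorem bracket_eq {x y : Hemisemidirect k p} {i j : ZMod 2} (hx : HasParity k p x i)
    (hy : HasParity k p y j) : bracket k p x.2 y.2 = x.2 * y.2 - sgn k i j • (y.2 * x.2) := by
  rw [HasParity] at hx hy
  rw [bracket, hx, hy]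
  rcases parity_cases i with rfl | rfl <;> rcases parity_cases j with rfl | rfl <;>
    simp [ZMod.val_one, two_smul]

theorem HasParity.mul {x y : Hemisemidirect k p} {i j : ZMod 2} (hx : HasParity k p x i)
    (hy : HasParity k p y j) : HasParity k p (x * y) (i + j) := by
  have e : (x * y).2 = bracket k p x.2 y.2 := rfl
  rw [HasParity, e, bracket_eq hx hy]
  rw [HasParity] at hx hy
  rw [map_sub, map_smul, oddPart_mul, oddPart_mul, hx, hy, val_add_parity]
  simp only [smul_mul_assoc, mul_smul_comm, smul_sub, smul_smul, smul_add]
  module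

/-- In the first coordinate this is associativity, since `[b, c]` acts as `bc ∓ cb`; in the second
it is the super Jacobi identity, checked for the eight choices of parities. All signs come from
second coordinates, so only these need a parity. -/
theorem leibniz {x y z : Hemisemidirect k p} {h i j : ZMod 2} (hx : HasParity k p x h)
    (hy : HasParity k p y i) (hz : HasParity k p z j) :
    x * (y * z) = (x * y) * z - sgn k j i • ((x * z) * y) := by
  refine Prod.ext ?_ ?_
  · change x.1 * bracket k p y.2 z.2 = x.1 * y.2 * z.2 - sgn k j i • (x.1 * z.2 * y.2)
    rw [bracket_eq hy hz, sgn_comm k j i, mul_sub, mul_smul_comm, mul_assoc, mul_assoc]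
  · change bracket k p x.2 (y * z).2 =
      bracket k p (x * y).2 z.2 - sgn k j i • bracket k p (x * z).2 y.2
    rw [bracket_eq hx (hy.mul hz), bracket_eq (hx.mul hy) hz, bracket_eq (hx.mul hz) hy]
    change x.2 * bracket k p y.2 z.2 - sgn k h (i + j) • (bracket k p y.2 z.2 * x.2) =
      bracket k p x.2 y.2 * z.2 - sgn k (h + i) j • (z.2 * bracket k p x.2 y.2)
      - sgn k j i • (bracket k p x.2 z.2 * y.2 - sgn k (h + j) i • (y.2 * bracket k p x.2 z.2))
    rw [bracket_eq hy hz, bracket_eq hx hy, bracket_eq hx hz]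
    rcases parity_cases h with rfl | rfl <;> rcases parity_cases i with rfl | rfl <;>
      rcases parity_cases j with rfl | rfl <;>
      simp [mul_sub, sub_mul, mul_add, add_mul, mul_assoc, show (1 : ZMod 2) + 1 = 0 from rfl] <;>
      abel

end Hemisemidirect

open Hemisemidirect in
/-- The left-normed words are linearly independent in `Lbs(X)`. -/
theorem linearIndependent_word : LinearIndependent k (word k p) := by
  -- The second coordinate of a letter appends it to the first coordinate of whatever stands on its
  -- left, so a left-normed word spells itself out there.
  let f : X → Hemisemidirect k p := fun x =>
    (MonoidAlgebra.single (FreeMonoid.of x) 1, MonoidAlgebra.single (FreeMonoid.of x) 1)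
  let Φ := FreeNonUnitalNonAssocAlgebra.lift k f
  have hgen : ∀ x, Φ (term k X (.of x)) = f x := FreeNonUnitalNonAssocAlgebra.lift_of_apply k f
  have hΦ : ∀ u, HasParity k p (Φ (term k X u)) (parity p u) := by
    intro u
    induction u with
    | ih1 x =>
      rw [hgen, HasParity]
      change oddPart k p (MonoidAlgebra.single (FreeMonoid.of x) 1) =
        ((p x).val : k) • MonoidAlgebra.single (FreeMonoid.of x) 1
      rw [oddPart_single]
      simp [listParity]
    | ih2 u v hu hv => rw [term_mul, map_mul]; exact hu.mul hv
  obtain ⟨φ, hφ⟩ := QuotientAlgebra.exists_lift (S := leibnizRelators k p) Φ (by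
    rintro _ ⟨u, v, w, rfl⟩
    simp only [map_add, map_sub, map_smul, term_mul, map_mul]
    rw [leibniz (hΦ u) (hΦ v) (hΦ w), sgn_comm k (parity p w)]
    abel)
  have hφgen : ∀ x, φ (gen k p x) = f x := fun x => (hφ _).trans (hgen x)
  have hword : ∀ w : FreeSemigroup X,
      (φ (word k p w)).1 = MonoidAlgebra.single (FreeMonoid.ofList (letters w)) 1 := by
    intro w
    induction w using word_induction with
    | of x => rw [word_of, hφgen]; rfl
    | snoc w x ih =>
      rw [← word_mul_gen, map_mul, hφgen]
      change (φ (word k p w)).1 * MonoidAlgebra.single (FreeMonoid.of x) 1 = _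
      rw [ih, MonoidAlgebra.single_mul_single, mul_one]
      rfl
  let L : FreeLeibniz k p →ₗ[k] (FreeMonoid X →₀ k) :=
    (MonoidAlgebra.coeffLinearEquiv k).toLinearMap ∘ₗ
      LinearMap.fst k (MonoidAlgebra k (FreeMonoid X)) (MonoidAlgebra k (FreeMonoid X)) ∘ₗ
      (φ : FreeLeibniz k p →ₗ[k] Hemisemidirect k p)
  refine LinearIndependent.of_comp L ?_
  have e : L ∘ word k p = fun w => Finsupp.single (FreeMonoid.ofList (letters w)) (1 : k) := by
    funext w
    change (φ (word k p w)).1.coeff = _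
    rw [hword, MonoidAlgebra.coeff_single]
  rw [e]
  exact (Finsupp.basisSingleOne (R := k)).linearIndependent.comp
    (fun w => FreeMonoid.ofList (letters w))
    (FreeMonoid.ofList.injective.comp letters_injective)
end Model

/-! ### The basis of left-normed words, and products as combinations of long words. -/

section Basis

variable (k : Type*) [Field k] {X : Type*} (p : X → ZMod 2)

theorem one_le_length (w : FreeSemigroup X) : 1 ≤ w.length := Nat.le_add_left 1 _

theorem mul_gen_mul_gen (f : FreeLeibniz k p) (a b : X) :
    f * (gen k p a * gen k p b) =
      f * gen k p a * gen k p b - sgn k (p a) (p b) • (f * gen k p b * gen k p a) := by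
  rw [sgn_comm]
  exact leibniz_of_mem k p f (gen_mem k p a) (gen_mem k p b)

theorem leftNormed_concat {A : Type*} [Mul A] (f x : A) (l : List A) :
    leftNormed f (l ++ [x]) = leftNormed f l * x := by
  simp [leftNormed]

theorem word_eq_mul {w : FreeSemigroup X} (hw : 2 ≤ w.length) :
    ∃ f g : FreeLeibniz k p, word k p w = f * g := by
  induction w using word_induction with
  | of x => simp at hw
  | snoc w x _ => exact ⟨_, _, (word_mul_gen k p w x).symm⟩

theorem isHomogeneous_leftNormed {s : FreeLeibniz k p} (hs : IsHomogeneous s) (l : List X) :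
    IsHomogeneous (leftNormed s (l.map (gen k p))) := by
  induction l generalizing s with
  | nil => exact hs
  | cons x l ih =>
    obtain ⟨i, hi⟩ := hs
    exact ih ⟨i + p x, (isLeibnizSuperalgebra k p).mul_mem _ _ _ _ hi (gen_mem k p x)⟩

theorem leftNormed_word_sub_smul (c : FreeSemigroup X) (a b : X) (t : k) (l : List X) :
    leftNormed (word k p (c * .of a * .of b) - t • word k p (c * .of b * .of a))
        (l.map (gen k p)) =
      word k p (appendWord (c * .of a * .of b) l)
        - t • word k p (appendWord (c * .of b * .of a) l) := by
  rw [← leftNormed_word, ← leftNormed_word]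
  generalize word k p (c * .of a * .of b) = f
  generalize word k p (c * .of b * .of a) = g
  induction l generalizing f g with
  | nil => rfl
  | cons x l ih =>
    change leftNormed ((f - t • g) * gen k p x) _ = _
    rw [sub_mul, smul_mul_assoc, ih]
    rfl

/-- The basis of `Lbs(X)` formed by the left-normed words. -/
def wordBasis : Module.Basis (FreeSemigroup X) k (FreeLeibniz k p) :=
  .mk (linearIndependent_word k p) (span_range_word k p).ge

theorem wordBasis_apply (w : FreeSemigroup X) : wordBasis k p w = word k p w :=
  Module.Basis.mk_apply _ _ w

/-- The span of the words of length at least two. -/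
def longSpan : Submodule k (FreeLeibniz k p) :=
  Submodule.span k (word k p '' {w | 2 ≤ w.length})

theorem mul_mem_longSpan (f g : FreeLeibniz k p) : f * g ∈ longSpan k p := by
  have hf : f ∈ Submodule.span k (Set.range (word k p)) := by rw [span_range_word]; trivial
  have hg : g ∈ Submodule.span k (Set.range (word k p)) := by rw [span_range_word]; trivial
  induction hf using Submodule.span_induction with
  | zero => rw [zero_mul]; exact Submodule.zero_mem _
  | add a b _ _ ha hb => rw [add_mul]; exact add_mem ha hb
  | smul c a _ ha => rw [smul_mul_assoc]; exact Submodule.smul_mem _ _ ha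
  | mem a ha =>
  obtain ⟨v, rfl⟩ := ha
  induction hg using Submodule.span_induction with
  | zero => rw [mul_zero]; exact Submodule.zero_mem _
  | add a b _ _ ha hb => rw [mul_add]; exact add_mem ha hb
  | smul c a _ ha => rw [mul_smul_comm]; exact Submodule.smul_mem _ _ ha
  | mem b hb =>
    obtain ⟨w, rfl⟩ := hb
    refine Submodule.span_mono (Set.image_mono ?_) (word_mul_word_mem k p v w)
    rintro u (hu : u.length = _)
    have hv := one_le_length v
    have hw := one_le_length w
    change 2 ≤ u.length
    omega

end Basis

/-! ### The relations and the ideal they generate -/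

section Ideal

variable (k : Type*) [Field k] {X : Type*} [LinearOrder X] (p : X → ZMod 2)

/-- The pairs of consecutive letters that do not occur in the tail of a normal word. -/
def Reducible (a b : X) : Prop := b < a ∨ a = b ∧ p a = 1 ∧ (2 : k) ≠ 0

/-- The coefficient `t` in the relation `[⋯ a b] = t [⋯ b a]` of a reducible pair. -/
def swapCoeff (a b : X) : k := if a = b then 0 else sgn k (p a) (p b)

/-- The relations `[c₁ ⋯ c_q a b] = t [c₁ ⋯ c_q b a]` with `q ≥ 2`, for the reducible pairs. -/
def swapRel : Set (FreeLeibniz k p) :=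
  {f | ∃ (c : FreeSemigroup X) (a b : X), 2 ≤ c.length ∧ Reducible k p a b ∧
    f = word k p (c * .of a * .of b) - swapCoeff k p a b • word k p (c * .of b * .of a)}

/-- The clause `2 ≠ 0` in `Reducible` removes the repeated odd letters here; this is what lets one
argument serve both characteristics. -/
theorem swapRel_eq_relS₁ (h : (2 : k) = 0) : swapRel k p = relS₁ k p := by
  ext f
  constructor
  · rintro ⟨c, a, b, hc, hab | ⟨-, -, h2⟩, rfl⟩
    · exact ⟨c, a, b, hc, hab, by rw [swapCoeff, if_neg hab.ne']⟩
    · exact absurd h h2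
  · rintro ⟨c, a, b, hc, hab, rfl⟩
    exact ⟨c, a, b, hc, .inl hab, by rw [swapCoeff, if_neg hab.ne']⟩

theorem swapRel_eq_relS' (h : (2 : k) ≠ 0) : swapRel k p = relS' k p := by
  ext f
  constructor
  · rintro ⟨c, a, b, hc, hab | ⟨rfl, ha, -⟩, rfl⟩
    · exact .inl ⟨c, a, b, hc, hab, by rw [swapCoeff, if_neg hab.ne']⟩
    · exact .inr ⟨c, a, hc, ha, by rw [swapCoeff, if_pos rfl, zero_smul, sub_zero]⟩
  · rintro (⟨c, a, b, hc, hab, rfl⟩ | ⟨c, a, hc, ha, rfl⟩)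
    · exact ⟨c, a, b, hc, .inl hab, by rw [swapCoeff, if_neg hab.ne']⟩
    · exact ⟨c, a, a, hc, .inr ⟨rfl, ha, h⟩,
        by rw [swapCoeff, if_pos rfl, zero_smul, sub_zero]⟩

/-- A relation is a multiple of the product `[c] (a b)`. -/
theorem exists_eq_smul_of_mem_swapRel {s : FreeLeibniz k p} (hs : s ∈ swapRel k p) :
    ∃ (t : k) (c : FreeSemigroup X) (a b : X), 2 ≤ c.length ∧
      s = t • (word k p c * (gen k p a * gen k p b)) := by
  obtain ⟨c, a, b, hc, hab | ⟨rfl, ha, h2⟩, rfl⟩ := hs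
  · exact ⟨1, c, a, b, hc, by
      rw [swapCoeff, if_neg hab.ne', mul_gen_mul_gen, one_smul]; simp only [word_mul_gen]⟩
  -- For odd `a` the Leibniz identity gives `[c](aa) = 2 [c a a]`.
  · refine ⟨2⁻¹, c, a, a, hc, ?_⟩
    rw [swapCoeff, if_pos rfl, mul_gen_mul_gen, ha, sgn_one_one, neg_one_smul, sub_neg_eq_add,
      ← two_smul k, smul_smul, inv_mul_cancel₀ h2]
    simp only [word_mul_gen, zero_smul, sub_zero, one_smul]

/-- The span of the products `[s a₁ ⋯ aₘ]`, for relations `s`. -/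
def swapSpan : Submodule k (FreeLeibniz k p) :=
  Submodule.span k {h | ∃ s ∈ swapRel k p, ∃ l : List X, h = leftNormed s (l.map (gen k p))}

theorem swapRel_subset_swapSpan : swapRel k p ⊆ swapSpan k p :=
  fun s hs => Submodule.subset_span ⟨s, hs, [], rfl⟩

theorem swapSpan_mul_gen (f : FreeLeibniz k p) (hf : f ∈ swapSpan k p) (x : X) :
    f * gen k p x ∈ swapSpan k p := by
  induction hf using Submodule.span_induction with
  | zero => rw [zero_mul]; exact Submodule.zero_mem _
  | add a b _ _ ha hb => rw [add_mul]; exact add_mem ha hb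
  | smul c a _ ha => rw [smul_mul_assoc]; exact Submodule.smul_mem _ _ ha
  | mem a ha =>
    obtain ⟨s, hs, l, rfl⟩ := ha
    exact Submodule.subset_span ⟨s, hs, l ++ [x], by
      rw [List.map_append, List.map_singleton, leftNormed_concat]⟩

/-- `[w](ab)` and `[w](ba)` agree up to sign, so only `b ≤ a` matters. For `b < a` it is a relation;
for `a = b` it is `0` if `a` is even and `2 [w a a]` if `a` is odd. -/
theorem word_mul_gen_mul_gen_mem {w : FreeSemigroup X} (hw : 2 ≤ w.length) (a b : X) :
    word k p w * (gen k p a * gen k p b) ∈ swapSpan k p := by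
  have key : ∀ a b : X, b < a → word k p w * (gen k p a * gen k p b) ∈ swapSpan k p := by
    intro a b h
    refine swapRel_subset_swapSpan k p ⟨w, a, b, hw, .inl h, ?_⟩
    rw [mul_gen_mul_gen, swapCoeff, if_neg h.ne']
    simp only [word_mul_gen]
  rcases lt_trichotomy a b with h | rfl | h
  · have e : word k p w * (gen k p a * gen k p b) =
        -sgn k (p a) (p b) • (word k p w * (gen k p b * gen k p a)) := by
      rw [mul_gen_mul_gen, mul_gen_mul_gen, sgn_comm k (p b), smul_sub, smul_smul, neg_mul,
        sgn_mul_self]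
      module
    rw [e]
    exact Submodule.smul_mem _ _ (key b a h)
  · rw [mul_gen_mul_gen]
    rcases parity_cases (p a) with ha | ha
    · rw [ha, sgn_zero_left, one_smul, sub_self]; exact Submodule.zero_mem _
    · rw [ha, sgn_one_one, neg_one_smul, sub_neg_eq_add, ← two_smul k]
      by_cases h2 : (2 : k) = 0
      · rw [h2, zero_smul]; exact Submodule.zero_mem _
      · refine Submodule.smul_mem _ _ (swapRel_subset_swapSpan k p
          ⟨w, a, a, hw, .inr ⟨rfl, ha, h2⟩, ?_⟩)
        rw [swapCoeff, if_pos rfl, zero_smul, sub_zero]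
        simp only [word_mul_gen]
  · exact key a b h

/-- Letters are peeled off the right factor until two remain; the left factor can only grow
meanwhile. -/
theorem word_mul_word_mem_swapSpan {v w : FreeSemigroup X} (hv : 2 ≤ v.length)
    (hw : 2 ≤ w.length) : word k p v * word k p w ∈ swapSpan k p := by
  induction w using word_induction generalizing v with
  | of x => simp at hw
  | snoc w x ih =>
    by_cases h : 2 ≤ w.length
    · rw [mul_word_snoc, word_mul_gen]
      refine sub_mem (swapSpan_mul_gen k p _ (ih hv h) x) (Submodule.smul_mem _ _ (ih ?_ h))
      rw [FreeSemigroup.length_mul]; omega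
    · obtain ⟨y, _ | ⟨z, l⟩⟩ := w
      · exact word_mul_gen_mul_gen_mem k p hv y x
      · exact absurd (show 2 ≤ (z :: l).length + 1 by simp) h

theorem longSpan_mul_longSpan {f g : FreeLeibniz k p} (hf : f ∈ longSpan k p)
    (hg : g ∈ longSpan k p) : f * g ∈ swapSpan k p := by
  induction hf using Submodule.span_induction with
  | zero => rw [zero_mul]; exact Submodule.zero_mem _
  | add a b _ _ ha hb => rw [add_mul]; exact add_mem ha hb
  | smul c a _ ha => rw [smul_mul_assoc]; exact Submodule.smul_mem _ _ ha
  | mem a ha =>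
  obtain ⟨v, hv, rfl⟩ := ha
  induction hg using Submodule.span_induction with
  | zero => rw [mul_zero]; exact Submodule.zero_mem _
  | add a b _ _ ha hb => rw [mul_add]; exact add_mem ha hb
  | smul c a _ ha => rw [mul_smul_comm]; exact Submodule.smul_mem _ _ ha
  | mem b hb =>
    obtain ⟨w, hw, rfl⟩ := hb
    exact word_mul_word_mem_swapSpan k p hv hw

theorem mul_mul_mul_mem_swapSpan (a b c d : FreeLeibniz k p) :
    (a * b) * (c * d) ∈ swapSpan k p :=
  longSpan_mul_longSpan k p (mul_mem_longSpan k p a b) (mul_mem_longSpan k p c d)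

theorem isHomogeneous_of_mem_swapRel {s : FreeLeibniz k p} (hs : s ∈ swapRel k p) :
    IsHomogeneous s := by
  obtain ⟨c, a, b, -, -, rfl⟩ := hs
  refine ⟨listParity p (letters (c * .of a * .of b)), ?_⟩
  refine sub_mem (word_mem_grading k p _) (Submodule.smul_mem _ _ ?_)
  convert word_mem_grading k p (c * .of b * .of a) using 2
  simp only [listParity, letters_mul, letters_of, List.map_append, List.sum_append,
    List.map_cons, List.map_nil, List.sum_cons, List.sum_nil]
  abel

/-- `f([c](ab))` expands into `(f[c])(ab)` and `(f(ab))[c]`. As `c` has at least two letters, `[c]`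
is a product, so both terms are products of two products. -/
theorem mul_mem_swapSpan_of_mem_swapRel (f : FreeLeibniz k p) {s : FreeLeibniz k p}
    (hs : s ∈ swapRel k p) : f * s ∈ swapSpan k p := by
  obtain ⟨t, c, a, b, hc, rfl⟩ := exists_eq_smul_of_mem_swapRel k p hs
  rw [mul_smul_comm]
  refine Submodule.smul_mem _ _ ?_
  rw [leibniz_of_mem k p f (word_mem_grading k p c)
    ((isLeibnizSuperalgebra k p).mul_mem _ _ _ _ (gen_mem k p a) (gen_mem k p b))]
  obtain ⟨g, h, e⟩ := word_eq_mul k p hc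
  rw [e]
  exact sub_mem (mul_mul_mul_mem_swapSpan k p _ _ _ _)
    (Submodule.smul_mem _ _ (mul_mul_mul_mem_swapSpan k p _ _ _ _))

theorem isIdeal_swapSpan : IsIdeal k (swapSpan k p) := by
  intro f g hg
  refine ⟨?_, mul_mem_of_mul_gen_mem k p (swapSpan_mul_gen k p) hg f⟩
  induction hg using Submodule.span_induction with
  | zero => rw [mul_zero]; exact Submodule.zero_mem _
  | add a b _ _ ha hb => rw [mul_add]; exact add_mem ha hb
  | smul c a _ ha => rw [mul_smul_comm]; exact Submodule.smul_mem _ _ ha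
  | mem h hh =>
    obtain ⟨s, hs, l, rfl⟩ := hh
    induction l using List.reverseRecOn generalizing f with
    | nil => exact mul_mem_swapSpan_of_mem_swapRel k p f hs
    -- From `f(hx) = (fh)x ∓ (fx)h` with `h = [s l]`: the last term needs the induction hypothesis
    -- for `fx` in place of `f`, and the sign needs `h` to be homogeneous.
    | append_singleton l x ih =>
      obtain ⟨i, hi⟩ := isHomogeneous_leftNormed k p (isHomogeneous_of_mem_swapRel k p hs) l
      rw [List.map_append, List.map_singleton, leftNormed_concat,
        leibniz_of_mem k p f hi (gen_mem k p x)]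
      exact sub_mem (swapSpan_mul_gen k p _ (ih f) x) (Submodule.smul_mem _ _ (ih _))

theorem idealSpan_swapRel : idealSpan k (swapRel k p) = swapSpan k p := by
  refine le_antisymm (idealSpan_le k (isIdeal_swapSpan k p) (swapRel_subset_swapSpan k p)) ?_
  refine Submodule.span_le.2 ?_
  rintro _ ⟨s, hs, l, rfl⟩
  induction l using List.reverseRecOn with
  | nil => exact subset_idealSpan k _ hs
  | append_singleton l x ih =>
    rw [List.map_append, List.map_singleton, leftNormed_concat]
    exact (isIdeal_idealSpan k _ _ _ ih).2

theorem idealSpan_metabelianRelators :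
    idealSpan k (metabelianRelators k p) = swapSpan k p := by
  refine le_antisymm (idealSpan_le k (isIdeal_swapSpan k p) ?_) ?_
  · rintro _ ⟨a, b, c, d, rfl⟩
    exact mul_mul_mul_mem_swapSpan k p a b c d
  · rw [← idealSpan_swapRel]
    refine idealSpan_le k (isIdeal_idealSpan k _) ?_
    intro s hs
    obtain ⟨t, c, a, b, hc, rfl⟩ := exists_eq_smul_of_mem_swapRel k p hs
    obtain ⟨g, h, e⟩ := word_eq_mul k p hc
    rw [e]
    exact Submodule.smul_mem _ _ (subset_idealSpan k _ ⟨g, h, _, _, rfl⟩)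

end Ideal

/-! ### The normal form modulo the ideal -/

section NormalForm

variable (k : Type*) [Field k] {X : Type*} [LinearOrder X] (p : X → ZMod 2)

/-- The words whose letters from the third on contain no reducible pair. -/
def IsNormalWord (w : FreeSemigroup X) : Prop :=
  ((letters w).drop 2).IsChain fun a b => ¬ Reducible k p a b

open Classical in
/-- The contribution of a pair of letters to the sign that sorts a word. -/
def pairSign (a b : X) : k := if Reducible k p a b then swapCoeff k p a b else 1

/-- The coefficient of the sorted word in the normal form of a list of commuting letters. -/
def sortSign : List X → k
  | [] => 1
  | a :: l => (l.map (pairSign k p a)).prod * sortSign l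

variable {k p}

theorem not_reducible_iff {a b : X} :
    ¬ Reducible k p a b ↔ a ≤ b ∧ (p a = 1 → (2 : k) ≠ 0 → a ≠ b) := by
  rw [Reducible]; push Not; tauto

theorem pairSign_swap {a b : X} (h : Reducible k p a b) :
    pairSign k p a b = swapCoeff k p a b * pairSign k p b a := by
  rw [pairSign, if_pos h]
  rcases eq_or_ne a b with rfl | hne
  · rw [swapCoeff, if_pos rfl, zero_mul]
  · have : ¬ Reducible k p b a := by
      rcases h with h | ⟨h, -⟩
      · rw [not_reducible_iff]; exact ⟨h.le, fun _ _ => h.ne⟩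
      · exact absurd h hne
    rw [pairSign, if_neg this, mul_one]

/-- `sortSign` is a product over all pairs of positions, and exchanging neighbours affects only the
factor of that pair. If `a = b`, this factor and the coefficient are both `0`. -/
theorem sortSign_swap {a b : X} (h : Reducible k p a b) (l m : List X) :
    sortSign k p (l ++ a :: b :: m) = swapCoeff k p a b * sortSign k p (l ++ b :: a :: m) := by
  induction l with
  | nil =>
    simp only [List.nil_append, sortSign, List.map_cons, List.prod_cons, pairSign_swap h]
    ring
  | cons x l ih =>
    have hp : (l ++ a :: b :: m).Perm (l ++ b :: a :: m) := (List.Perm.swap b a m).append_left l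
    simp only [List.cons_append, sortSign, ih, (hp.map (pairSign k p x)).prod_eq]
    ring

/-- Irreducibility is transitive: if `a ≤ b ≤ c` and `a = c`, then already `a = b`. -/
theorem pairwise_of_isChain {l : List X} (h : l.IsChain fun a b => ¬ Reducible k p a b) :
    l.Pairwise fun a b => ¬ Reducible k p a b := by
  have : IsTrans X fun a b => ¬ Reducible k p a b := ⟨by
    intro a b c hab hbc
    rw [not_reducible_iff] at *
    refine ⟨hab.1.trans hbc.1, ?_⟩
    rintro ha h2 rfl
    exact hab.2 ha h2 (le_antisymm hab.1 hbc.1)⟩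
  exact List.isChain_iff_pairwise.1 h

theorem sortSign_eq_one {l : List X} (h : l.IsChain fun a b => ¬ Reducible k p a b) :
    sortSign k p l = 1 := by
  replace h := pairwise_of_isChain h
  induction h with
  | nil => rfl
  | @cons a l ha _ ih =>
    have : l.map (pairSign k p a) = l.map fun _ => 1 :=
      List.map_congr_left fun b hb => by rw [pairSign, if_neg (ha b hb)]
    rw [sortSign, ih, this]
    simp

variable (k p)

/-- The first two letters of a word and the multiset of the others. -/
def wordKey (w : FreeSemigroup X) : List X × Multiset X :=
  ((letters w).take 2, ((letters w).drop 2 : List X))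

/-- The normal form of the elements of `Lbs(X)` modulo the ideal of `MLbs(X)`. -/
def normalForm : FreeLeibniz k p →ₗ[k] (List X × Multiset X →₀ k) :=
  (wordBasis k p).constr k fun w =>
    Finsupp.single (wordKey w) (sortSign k p ((letters w).drop 2))

theorem normalForm_word (w : FreeSemigroup X) :
    normalForm k p (word k p w) =
      Finsupp.single (wordKey w) (sortSign k p ((letters w).drop 2)) := by
  rw [← wordBasis_apply, normalForm, Module.Basis.constr_basis]

/-- The two words of a relation differ by a swap beyond the second letter, so they share a key, and
`sortSign_swap` matches their coefficients. -/
theorem normalForm_eq_zero {f : FreeLeibniz k p} (hf : f ∈ swapSpan k p) :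
    normalForm k p f = 0 := by
  induction hf using Submodule.span_induction with
  | zero => rw [map_zero]
  | add a b _ _ ha hb => rw [map_add, ha, hb, add_zero]
  | smul c a _ ha => rw [map_smul, ha, smul_zero]
  | mem h hh =>
    obtain ⟨_, ⟨c, a, b, hc, hab, rfl⟩, l, rfl⟩ := hh
    rw [leftNormed_word_sub_smul, map_sub, map_smul, normalForm_word, normalForm_word]
    rw [← length_letters] at hc
    have e : ∀ a b : X, letters (appendWord (c * .of a * .of b) l) =
        letters c ++ a :: b :: l := by
      intro a b; simp [letters_appendWord, letters_mul, letters_of]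
    have hp : ((letters c).drop 2 ++ a :: b :: l).Perm ((letters c).drop 2 ++ b :: a :: l) :=
      (List.Perm.swap b a l).append_left _
    simp only [wordKey, e, List.take_append_of_le_length hc, List.drop_append_of_le_length hc,
      sortSign_swap hab, Multiset.coe_eq_coe.2 hp, Finsupp.smul_single, smul_eq_mul, sub_self]

/-- The tail of a normal word is sorted, hence determined by its multiset of letters. -/
theorem wordKey_injOn : Set.InjOn wordKey {w : FreeSemigroup X | IsNormalWord k p w} := by
  intro v hv w hw h
  rw [wordKey, wordKey, Prod.mk.injEq, Multiset.coe_eq_coe] at h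
  have hsort : ∀ u : FreeSemigroup X, IsNormalWord k p u →
      ((letters u).drop 2).Pairwise (· ≤ ·) := fun u hu =>
    (pairwise_of_isChain hu).imp fun hab => (not_reducible_iff.1 hab).1
  apply letters_injective
  rw [← List.take_append_drop 2 (letters v), ← List.take_append_drop 2 (letters w), h.1,
    h.2.eq_of_pairwise' (hsort v hv) (hsort w hw)]

theorem linearIndependent_normalForm_word :
    LinearIndependent k fun w : {w : FreeSemigroup X // IsNormalWord k p w} =>
      normalForm k p (word k p w) := by
  have e : (fun w : {w : FreeSemigroup X // IsNormalWord k p w} => normalForm k p (word k p w)) =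
      fun w => Finsupp.single (wordKey w.1) (1 : k) := by
    funext w
    rw [normalForm_word, sortSign_eq_one w.2]
  rw [e]
  exact (Finsupp.basisSingleOne (R := k)).linearIndependent.comp
    (fun w : {w : FreeSemigroup X // IsNormalWord k p w} => wordKey w.1)
    fun v w h => Subtype.ext (wordKey_injOn k p v.2 w.2 h)

/-- A linear combination of normal words that lies in the ideal vanishes. -/
theorem eq_zero_of_mem_swapSpan {f : FreeLeibniz k p}
    (hf : f ∈ Submodule.span k (word k p '' {w | IsNormalWord k p w})) (h : f ∈ swapSpan k p) :
    f = 0 := by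
  rw [Set.image_eq_range] at hf
  obtain ⟨c, rfl⟩ := (Finsupp.mem_span_range_iff_exists_finsupp).1 hf
  have h0 := normalForm_eq_zero k p h
  simp only [Finsupp.sum, map_sum, map_smul] at h0
  have hc : c = 0 := linearIndependent_iff.1 (linearIndependent_normalForm_word k p) c h0
  rw [hc, Finsupp.sum_zero_index]

end NormalForm

/-! ### The length-lexicographic order and leading monomials -/

section Order

variable {X : Type*}

theorem degree_one (w : FreeSemigroup X) : degree (fun _ => 1) w = w.length := by
  simp [degree, length_letters]

variable [LinearOrder X]

theorem wordLT_iff {v w : FreeSemigroup X} :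
    wordLT (fun _ => 1) v w ↔
      v.length < w.length ∨ v.length = w.length ∧ letters v < letters w := by
  rw [wordLT, degree_one, degree_one]
  change _ ∨ _ ∧ (_ ∨ _ ∧ letters v < letters w) ↔ _
  constructor
  · rintro (h | ⟨h, h' | h'⟩)
    exacts [.inl h, .inl h', .inr h']
  · rintro (h | h)
    exacts [.inl h, .inr ⟨h.1, .inr h⟩]

theorem wordLT_trans {u v w : FreeSemigroup X} (h : wordLT (fun _ => 1) u v)
    (h' : wordLT (fun _ => 1) v w) : wordLT (fun _ => 1) u w := by
  rw [wordLT_iff] at *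
  rcases h with h | ⟨h, hl⟩ <;> rcases h' with h' | ⟨h', hl'⟩
  · exact .inl (h.trans h')
  · exact .inl (h.trans_eq h')
  · exact .inl (h.trans_lt h')
  · exact .inr ⟨h.trans h', hl.trans hl'⟩

theorem wordLT_irrefl (w : FreeSemigroup X) : ¬ wordLT (fun _ => 1) w w := by
  simp [wordLT_iff]

theorem wordLT_trichotomy (v w : FreeSemigroup X) :
    wordLT (fun _ => 1) v w ∨ v = w ∨ wordLT (fun _ => 1) w v := by
  simp only [wordLT_iff]
  rcases lt_trichotomy v.length w.length with h | h | h
  · exact .inl (.inl h)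
  · rcases lt_trichotomy (letters v) (letters w) with hl | hl | hl
    · exact .inl (.inr ⟨h, hl⟩)
    · exact .inr (.inl (letters_injective hl))
    · exact .inr (.inr (.inr ⟨h.symm, hl⟩))
  · exact .inr (.inr (.inl h))

/-- This makes the rewriting of words terminate. -/
theorem wellFounded_wordLT [WellFoundedLT X] :
    WellFounded (wordLT (X := X) fun _ => 1) := by
  refine Subrelation.wf ?_ (InvImage.wf letters (List.Shortlex.wf (wellFounded_lt (α := X))))
  intro v w h
  exact List.shortlex_def.2 (wordLT_iff.1 h)

theorem wordLT_swap (c : FreeSemigroup X) {a b : X} (h : b < a) (l : List X) :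
    wordLT (fun _ => 1) (appendWord (c * .of b * .of a) l)
      (appendWord (c * .of a * .of b) l) := by
  rw [wordLT_iff]
  refine .inr ⟨by simp [length_appendWord, FreeSemigroup.length_mul], ?_⟩
  simp only [letters_appendWord, letters_mul, letters_of, List.append_assoc,
    List.cons_append, List.nil_append]
  exact List.append_left_lt (List.cons_lt_cons_iff.2 (.inl h))

end Order

section LeadingTerm

variable {k : Type*} [Field k] {X : Type*} {p : X → ZMod 2}

theorem repr_eq_zero_of_mem_span {f : FreeLeibniz k p} {D : Set (FreeSemigroup X)}
    (hf : f ∈ Submodule.span k (word k p '' D)) {w : FreeSemigroup X} (hw : w ∉ D) :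
    (wordBasis k p).repr f w = 0 := by
  induction hf using Submodule.span_induction with
  | zero => simp
  | add a b _ _ ha hb => rw [map_add, Finsupp.add_apply, ha, hb, add_zero]
  | smul c a _ ha => rw [map_smul, Finsupp.smul_apply, ha, smul_zero]
  | mem a ha =>
    obtain ⟨v, hv, rfl⟩ := ha
    rw [← wordBasis_apply, Module.Basis.repr_self, Finsupp.single_eq_of_ne]
    rintro rfl
    exact hw hv

theorem mul_mem_span_length (u : FreeSemigroup X) {f : FreeLeibniz k p} {n : ℕ}
    (hf : f ∈ Submodule.span k (word k p '' {v | v.length ≤ n})) :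
    word k p u * f ∈ Submodule.span k (word k p '' {v | v.length ≤ u.length + n}) := by
  induction hf using Submodule.span_induction with
  | zero => rw [mul_zero]; exact Submodule.zero_mem _
  | add a b _ _ ha hb => rw [mul_add]; exact add_mem ha hb
  | smul c a _ ha => rw [mul_smul_comm]; exact Submodule.smul_mem _ _ ha
  | mem a ha =>
    obtain ⟨v, hv, rfl⟩ := ha
    refine Submodule.span_mono (Set.image_mono ?_) (word_mul_word_mem k p u v)
    rintro w (hw : w.length = _)
    exact hw.trans_le (Nat.add_le_add_left hv _)

variable [LinearOrder X]

theorem HasLeadingTerm.repr_eq {f : FreeLeibniz k p} {w : FreeSemigroup X} {c : k}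
    (h : HasLeadingTerm (fun _ => 1) f w c) : (wordBasis k p).repr f w = c := by
  have := repr_eq_zero_of_mem_span h.2 (wordLT_irrefl w)
  rw [map_sub, map_smul, ← wordBasis_apply, Module.Basis.repr_self] at this
  simpa [sub_eq_zero] using this

theorem HasLeadingTerm.repr_eq_zero {f : FreeLeibniz k p} {v w : FreeSemigroup X} {c : k}
    (h : HasLeadingTerm (fun _ => 1) f w c) (hv : wordLT (fun _ => 1) w v) :
    (wordBasis k p).repr f v = 0 := by
  have := repr_eq_zero_of_mem_span h.2 (w := v) fun h' => wordLT_irrefl _ (wordLT_trans hv h')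
  have hne : v ≠ w := by rintro rfl; exact wordLT_irrefl _ hv
  rw [map_sub, map_smul, ← wordBasis_apply, Module.Basis.repr_self] at this
  simpa [Finsupp.single_eq_of_ne hne] using this

theorem HasLeadingTerm.unique {f : FreeLeibniz k p} {v w : FreeSemigroup X} {c d : k}
    (h : HasLeadingTerm (fun _ => 1) f v c) (h' : HasLeadingTerm (fun _ => 1) f w d) :
    v = w ∧ c = d := by
  rcases wordLT_trichotomy v w with hlt | rfl | hlt
  · exact absurd (h'.repr_eq.symm.trans (h.repr_eq_zero hlt)) h'.1
  · exact ⟨rfl, h.repr_eq.symm.trans h'.repr_eq⟩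
  · exact absurd (h.repr_eq.symm.trans (h'.repr_eq_zero hlt)) h.1

/-- Appending letters keeps the order of the two words, so the normal polynomial stays monic. For `a
= b` the second word has coefficient `0`. -/
theorem hasLeadingTerm_swap (c : FreeSemigroup X) {a b : X} (h : Reducible k p a b)
    (l : List X) :
    HasLeadingTerm (fun _ => 1)
      (leftNormed (word k p (c * .of a * .of b) -
        swapCoeff k p a b • word k p (c * .of b * .of a)) (l.map (gen k p)))
      (appendWord (c * .of a * .of b) l) 1 := by
  refine ⟨one_ne_zero, ?_⟩
  rw [leftNormed_word_sub_smul, one_smul, sub_sub_cancel_left]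
  refine Submodule.neg_mem _ ?_
  rcases h with h | ⟨rfl, -⟩
  · exact Submodule.smul_mem _ _ (Submodule.subset_span ⟨_, wordLT_swap c h l, rfl⟩)
  · rw [swapCoeff, if_pos rfl, zero_smul]; exact Submodule.zero_mem _

theorem exists_hasLeadingTerm {s : FreeLeibniz k p} (hs : s ∈ swapRel k p) (l : List X) :
    ∃ w, 4 ≤ w.length ∧ HasLeadingTerm (fun _ => 1) (leftNormed s (l.map (gen k p))) w 1 := by
  obtain ⟨c, a, b, hc, hab, rfl⟩ := hs
  refine ⟨_, ?_, hasLeadingTerm_swap c hab l⟩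
  simp only [length_appendWord, FreeSemigroup.length_mul, FreeSemigroup.length_of]
  omega

theorem HasLeadingTerm.mem_span_length {f : FreeLeibniz k p} {w : FreeSemigroup X} {c : k}
    (h : HasLeadingTerm (fun _ => 1) f w c) :
    f ∈ Submodule.span k (word k p '' {v | v.length ≤ w.length}) := by
  rw [← sub_add_cancel f (c • word k p w)]
  refine add_mem (Submodule.span_mono (Set.image_mono ?_) h.2)
    (Submodule.smul_mem _ _ (Submodule.subset_span ⟨w, le_refl w.length, rfl⟩))
  intro v hv
  rcases wordLT_iff.1 hv with hv | ⟨hv, -⟩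
  exacts [hv.le, hv.le]

theorem mem_swapSpan_of_isNormalPoly {h : FreeLeibniz k p}
    (hh : IsNormalPoly (fun _ => 1) (swapRel k p) h) : h ∈ swapSpan k p := by
  obtain ⟨s, hs, ⟨l, rfl⟩ | ⟨⟨x, c, hc⟩, -⟩⟩ := hh
  · exact Submodule.subset_span ⟨s, hs, l, rfl⟩
  -- Leading words of relations have length at least four, so normal polynomials with `s` in an
  -- inner position do not occur.
  · obtain ⟨w, hw, hlead⟩ := exists_hasLeadingTerm hs []
    obtain ⟨rfl, -⟩ := hlead.unique hc
    simp at hw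

end LeadingTerm

/-! ### Reduction to normal words -/

section Reduction

variable {k : Type*} [Field k] {X : Type*} [LinearOrder X] [WellFoundedLT X] {p : X → ZMod 2}

/-- Rewriting a reducible pair subtracts a normal polynomial led by the current word and leaves a
smaller word or nothing. The downward closed set `D` carries the bound on leading monomials: by
length, by a given word, or none. -/
theorem word_mem_normal_sup {D : Set (FreeSemigroup X)}
    (hD : ∀ w ∈ D, ∀ v, wordLT (fun _ => 1) v w → v ∈ D) {w : FreeSemigroup X} (hw : w ∈ D) :
    word k p w ∈ Submodule.span k (word k p '' {w | IsNormalWord k p w}) ⊔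
      Submodule.span k {h | IsNormalPoly (fun _ => 1) (swapRel k p) h ∧
        ∃ v, HasLeadingMonomial (fun _ => 1) h v ∧ v ∈ D} := by
  induction (wellFounded_wordLT (X := X)).apply w with
  | intro w _ ih =>
  by_cases hn : IsNormalWord k p w
  · exact Submodule.mem_sup_left (Submodule.subset_span ⟨w, hn, rfl⟩)
  rw [IsNormalWord, List.isChain_iff_forall_rel_of_append_cons_cons] at hn
  push Not at hn
  obtain ⟨a, b, l, m, e, hab⟩ := hn
  -- The pair occurs after the first two letters, so the prefix before it is long enough for a
  -- relation.
  obtain ⟨c, hc, rfl⟩ : ∃ c : FreeSemigroup X, 2 ≤ c.length ∧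
      w = appendWord (c * .of a * .of b) m := by
    obtain ⟨x, _ | ⟨y, t⟩⟩ := w
    · simp [letters] at e
    · refine ⟨⟨x, y :: l⟩, by simp [FreeSemigroup.length], letters_injective ?_⟩
      simp only [letters, List.drop_succ_cons, List.drop_zero] at e
      simp [letters, appendWord, FreeSemigroup.of, e]
  have hlead := hasLeadingTerm_swap c hab m
  set s := word k p (c * .of a * .of b) - swapCoeff k p a b • word k p (c * .of b * .of a) with hs
  have e : word k p (appendWord (c * .of a * .of b) m) = leftNormed s (m.map (gen k p)) +
      swapCoeff k p a b • word k p (appendWord (c * .of b * .of a) m) := by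
    rw [hs, leftNormed_word_sub_smul, sub_add_cancel]
  rw [e]
  refine add_mem (Submodule.mem_sup_right (Submodule.subset_span
    ⟨⟨s, ⟨c, a, b, hc, hab, hs⟩, .inl ⟨m, rfl⟩⟩, _, ⟨1, hlead⟩, hw⟩)) ?_
  rcases hab with hab | ⟨rfl, -⟩
  · have hlt := wordLT_swap c hab m
    exact Submodule.smul_mem _ _ (ih _ hlt (hD _ hw _ hlt))
  · rw [swapCoeff, if_pos rfl, zero_smul]; exact Submodule.zero_mem _

/-- An element of the ideal is a combination of normal polynomials whose leading monomials are
bounded by its own monomials. -/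
theorem mem_span_normalPoly {D : Set (FreeSemigroup X)}
    (hD : ∀ w ∈ D, ∀ v, wordLT (fun _ => 1) v w → v ∈ D) {f : FreeLeibniz k p}
    (hf : f ∈ Submodule.span k (word k p '' D)) (hfJ : f ∈ swapSpan k p) :
    f ∈ Submodule.span k {h | IsNormalPoly (fun _ => 1) (swapRel k p) h ∧
        ∃ v, HasLeadingMonomial (fun _ => 1) h v ∧ v ∈ D} := by
  have hle : Submodule.span k (word k p '' D) ≤ _ := Submodule.span_le.2 (by
    rintro _ ⟨w, hw, rfl⟩
    exact word_mem_normal_sup hD hw)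
  obtain ⟨g, hg, h, hh, rfl⟩ := Submodule.mem_sup.1 (hle hf)
  have hhJ : h ∈ swapSpan k p :=
    Submodule.span_le.2 (fun t ht => mem_swapSpan_of_isNormalPoly ht.1) hh
  -- The normal part `g` is a difference of elements of the ideal, hence zero.
  rw [eq_zero_of_mem_swapSpan k p hg ((Submodule.add_mem_iff_left _ hhJ).1 hfJ), zero_add]
  exact hh

variable (k p) in
theorem isGroebnerShirshovBasis_swapRel :
    IsGroebnerShirshovBasis (fun _ => 1) (swapRel k p) where
  monic f hf := by
    obtain ⟨w, -, hw⟩ := exists_hasLeadingTerm hf []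
    exact ⟨w, hw⟩
  homogeneous f hf := isHomogeneous_of_mem_swapRel k p hf
  left_multiplication := by
    rintro f hf w ⟨c, hw⟩ - u -
    rw [TrivialModDegree]
    simp only [degree_one]
    refine mem_span_normalPoly (D := {v | v.length ≤ u.length + w.length}) ?_
      (mul_mem_span_length u hw.mem_span_length) (mul_mem_swapSpan_of_mem_swapRel k p _ hf)
    intro v hv v' h
    have hle : v'.length ≤ v.length := by
      rcases wordLT_iff.1 h with h | ⟨h, -⟩
      exacts [h.le, h.le]
    exact hle.trans hv
  inclusion := by
    rintro f hf g hg - w ⟨c, hw⟩ h hh ⟨d, hd⟩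
    have hhJ := mem_swapSpan_of_isNormalPoly ⟨g, hg, hh⟩
    have hc : c = 1 := by
      obtain ⟨v, -, hv⟩ := exists_hasLeadingTerm hf []
      exact (hw.unique hv).2
    have hd1 : d = 1 := by
      rcases hh with ⟨l, rfl⟩ | ⟨⟨x, t, ht⟩, -⟩
      · obtain ⟨v, -, hv⟩ := exists_hasLeadingTerm hg l
        exact (hd.unique hv).2
      · obtain ⟨v, hv, hlead⟩ := exists_hasLeadingTerm hg []
        obtain ⟨rfl, -⟩ := hlead.unique ht
        simp at hv
    subst hc hd1
    -- Both leading coefficients are `1`, so `[w]` cancels in `f - h` and only smaller words remain.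
    refine mem_span_normalPoly (D := {v | wordLT (fun _ => 1) v w})
      (fun v hv v' h => wordLT_trans h hv) ?_
      (sub_mem (swapRel_subset_swapSpan k p hf) hhJ)
    rw [← sub_sub_sub_cancel_right f h ((1 : k) • word k p w)]
    exact sub_mem hw.2 hd.2

end Reduction

/-! ### The basis of `MLbs(X)` -/

section MetabelianBasis

variable (k : Type*) [Field k] {X : Type*} (p : X → ZMod 2)

theorem proj_word (w : FreeSemigroup X) :
    QuotientAlgebra.proj k (metabelianRelators k p) (FreeLeibniz.word k p w) =
      FreeMetabelian.word k p w := by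
  induction w using word_induction with
  | of x => rfl
  | snoc w x ih =>
    rw [← word_mul_gen, QuotientAlgebra.proj_mul, ih]
    simp [FreeMetabelian.word, leftNormed, FreeMetabelian.gen, FreeSemigroup.of]

variable [LinearOrder X]

/-- A relation among classes of normal words lifts to an element of the ideal, which `normalForm`
kills while keeping normal words independent. -/
theorem linearIndependent_metabelian_word :
    LinearIndependent k fun w : {w : FreeSemigroup X // IsNormalWord k p w} =>
      FreeMetabelian.word k p w := by
  rw [linearIndependent_iff]
  intro c hc
  have hJ : Finsupp.linearCombination k
      (fun w : {w : FreeSemigroup X // IsNormalWord k p w} => FreeLeibniz.word k p w) c ∈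
      swapSpan k p := by
    rw [← idealSpan_metabelianRelators, ← QuotientAlgebra.proj_eq_zero,
      Finsupp.apply_linearCombination, ← hc]
    congr 2
    funext w
    exact proj_word k p w
  have h0 := normalForm_eq_zero k p hJ
  rw [Finsupp.apply_linearCombination] at h0
  exact linearIndependent_iff.1 (linearIndependent_normalForm_word k p) c h0

theorem span_metabelian_word [WellFoundedLT X] :
    Submodule.span k (Set.range fun w : {w : FreeSemigroup X // IsNormalWord k p w} =>
      FreeMetabelian.word k p w) = ⊤ := by
  rw [eq_top_iff]
  rintro f -
  obtain ⟨f, rfl⟩ := QuotientAlgebra.proj_surjective k _ f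
  have hf : f ∈ Submodule.span k (Set.range (FreeLeibniz.word k p)) := by
    rw [span_range_word]; trivial
  induction hf using Submodule.span_induction with
  | zero => rw [map_zero]; exact Submodule.zero_mem _
  | add a b _ _ ha hb => rw [map_add]; exact add_mem ha hb
  | smul c a _ ha => rw [map_smul]; exact Submodule.smul_mem _ _ ha
  | mem a ha =>
    obtain ⟨w, rfl⟩ := ha
    obtain ⟨g, hg, h, hh, e⟩ := Submodule.mem_sup.1
      (word_mem_normal_sup (k := k) (p := p) (D := Set.univ) (fun _ _ _ _ => trivial)
        (Set.mem_univ w))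
    have hhJ : h ∈ swapSpan k p :=
      Submodule.span_le.2 (fun t ht => mem_swapSpan_of_isNormalPoly ht.1) hh
    rw [← idealSpan_metabelianRelators, ← QuotientAlgebra.proj_eq_zero] at hhJ
    rw [← e, map_add, hhJ, add_zero]
    have hg' := Submodule.mem_map_of_mem (f := QuotientAlgebra.proj k (metabelianRelators k p)) hg
    rw [Submodule.map_span, Set.image_image, Set.image_eq_range] at hg'
    simp only [proj_word] at hg'
    exact hg'

theorem isLinearBasis_of_iff [WellFoundedLT X] {P : FreeSemigroup X → Prop}
    (hP : ∀ w, P w ↔ IsNormalWord k p w) :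
    IsLinearBasis k fun w : {w : FreeSemigroup X // P w} => FreeMetabelian.word k p w := by
  obtain rfl : P = IsNormalWord k p := funext fun w => propext (hP w)
  exact ⟨linearIndependent_metabelian_word k p, span_metabelian_word k p⟩

end MetabelianBasis

end LeibnizSuper

end

theorem mainTheorem4 {k : Type*} [Field k] {X : Type*} [LinearOrder X] [WellFoundedLT X]
    (p : X → ZMod 2) :
    (ringChar k = 2 →
      IsGroebnerShirshovBasis (fun _ => 1) (relS₁ k p) ∧
      idealSpan k (relS₁ k p) = idealSpan k (metabelianRelators k p) ∧
      IsLinearBasis k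
        (fun w : {w : FreeSemigroup X // IsTailSorted w} => FreeMetabelian.word k p w)) ∧
    (ringChar k ≠ 2 →
      IsGroebnerShirshovBasis (fun _ => 1) (relS' k p) ∧
      idealSpan k (relS' k p) = idealSpan k (metabelianRelators k p) ∧
      IsLinearBasis k
        (fun w : {w : FreeSemigroup X // IsTailSorted w ∧ NoOddRepeat p w} =>
          FreeMetabelian.word k p w)) := by
  constructor
  · intro h
    have h2 : (2 : k) = 0 := by
      simpa using (ringChar.spec k 2).2 (dvd_of_eq h)
    rw [← swapRel_eq_relS₁ k p h2]
    refine ⟨isGroebnerShirshovBasis_swapRel k p,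
      (idealSpan_swapRel k p).trans (idealSpan_metabelianRelators k p).symm,
      isLinearBasis_of_iff k p fun w => ?_⟩
    simp [IsNormalWord, IsTailSorted, not_reducible_iff, h2]
  · intro h
    have h2 : (2 : k) ≠ 0 := Ring.two_ne_zero h
    rw [← swapRel_eq_relS' k p h2]
    refine ⟨isGroebnerShirshovBasis_swapRel k p,
      (idealSpan_swapRel k p).trans (idealSpan_metabelianRelators k p).symm,
      isLinearBasis_of_iff k p fun w => ?_⟩
    -- Stating chains through adjacent pairs lets the conjunction of conditions split into two
    -- separate chains.
    simp only [IsNormalWord, IsTailSorted, NoOddRepeat, not_reducible_iff,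
      List.isChain_iff_forall_rel_of_append_cons_cons]
    exact ⟨fun hw a b l m e => ⟨hw.1 e, fun ha _ => hw.2 e ha⟩,
      fun hw => ⟨fun a b l m e => (hw e).1, fun a b l m e ha => (hw e).2 ha h2⟩⟩
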